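/- Let $n\in\mathbb N$ and $t>0$. For $s>0$ let $d\mu_s(z)=(\pi s)^{-n}e^{-|z|^2/s}\,dV(z)$ on $\mathbb C^n$, where $V$ is Lebesgue measure. For $1<p<\infty$ let $F_t^p=L^p(\mathbb C^n,\mu_{2t/p})\cap\operatorname{Hol}(\mathbb C^n)$, with the norm of $L^p(\mathbb C^n,\mu_{2t/p})$, and for a bounded continuous function $f$ on $\mathbb C^n$ let $T_f^t\in\mathcal L(F_t^p)$ be the Toeplitz operator $$T_f^t g(z)=\int_{\mathbb C^n}e^{z\cdot\overline w/t}f(w)g(w)\,d\mu_t(w).$$ Let $\operatorname{BUC}(\mathbb C^n)$ be the space of bounded uniformly continuous functions $\mathbb C^n\to\mathbb C$ with the supremum norm. Call a set $S\subseteq\operatorname{BUC}(\mathbb C^n)$ $\alpha$-invariant if $f(\cdot-z)\in S$ for all $f\in S$ and $z\in\mathbb C^n$. Let $\mathcal T_{lin}^{p,t}(S)\subseteq\mathcal L(F_t^p)$ be the operator norm closure of the linear span of $\{T_f^t: f\in S\}$, and let $\mathcal T^{p,t}(S)\subseteq\mathcal L(F_t^p)$ be the (not necessarily unital) Banach algebra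 generated by $\{T_f^t: f\in S\}$, i.e. the operator norm closure of the algebra of all finite linear combinations of products of one or more of these operators. Let $\mathcal D_0\subseteq\operatorname{BUC}(\mathbb C^n)$ be closed and $\alpha$-invariant (it need not be a linear subspace). 1. The equality $\mathcal T_{lin}^{p,t}(\mathcal D_0)=\mathcal T^{p,t}(\mathcal D_0)$ holds for one $p\in(1,\infty)$ if and only if it holds for all $p\in(1,\infty)$. 2. Assume that the equality in 1. holds for one (equivalently, every) $p\in(1,\infty)$, and let $\mathcal I\subseteq\mathcal D_0$ be closed and $\alpha$-invariant. Then $\mathcal T_{lin}^{p,t}(\mathcal I)$ is a left ideal in $\mathcal T_{lin}^{p,t}(\mathcal D_0)$ for one $p\in(1,\infty)$ if and only if it is a left ideal in $\mathcal T_{lin}^{p,t}(\mathcal D_0)$ for all $p\in(1,\infty)$. The same holds with "left ideal" replaced by "right ideal", and with "left ideal" replaced by "two-sided ideal". -/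

import Mathlib

open MeasureTheory
open scoped BoundedContinuousFunction ENNReal

namespace Fock

/-- `ℂⁿ`. -/
abbrev Cn (n : ℕ) : Type := Fin n → ℂ

noncomputable section

/-- The square `|z|²` of the Euclidean norm. -/
def sqNorm {n : ℕ} (z : Cn n) : ℝ := ∑ i, ‖z i‖ ^ 2

/-- `z ⬝ conj w`. -/
def herm {n : ℕ} (z w : Cn n) : ℂ := ∑ i, z i * (starRingEnd ℂ) (w i)

/-- The density `(π t)⁻ⁿ exp (-|z|² / t)` of `μ_t`. -/
def gaussianDensity (n : ℕ) (t : ℝ) (z : Cn n) : ℝ :=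
  1 / (Real.pi * t) ^ n * Real.exp (-(sqNorm z) / t)

/-- The Gaussian measure `μ_t` on `ℂⁿ`. -/
def gaussianMeasure (n : ℕ) (t : ℝ) : Measure (Cn n) :=
  volume.withDensity fun z => ENNReal.ofReal (gaussianDensity n t z)

theorem sqNorm_sub {n : ℕ} (z w : Cn n) :
    sqNorm (z - w) = sqNorm z + sqNorm w - 2 * (herm z w).re := by
  simp only [sqNorm, herm, Complex.re_sum, Finset.mul_sum, ← Finset.sum_add_distrib,
    ← Finset.sum_sub_distrib, Pi.sub_apply]
  refine Finset.sum_congr rfl fun i _ => ?_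
  rw [← Complex.normSq_eq_norm_sq, ← Complex.normSq_eq_norm_sq, ← Complex.normSq_eq_norm_sq,
    Complex.normSq_sub]

theorem continuous_sqNorm {n : ℕ} : Continuous (sqNorm : Cn n → ℝ) := by
  unfold sqNorm; fun_prop

theorem continuous_gaussianDensity {n : ℕ} {t : ℝ} : Continuous (gaussianDensity n t) := by
  unfold gaussianDensity
  have := @continuous_sqNorm n
  fun_prop

theorem gaussianDensity_pos {n : ℕ} {t : ℝ} (ht : 0 < t) (z : Cn n) :
    0 < gaussianDensity n t z := by
  unfold gaussianDensity; have := Real.pi_pos; positivity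

theorem volume_ac {n : ℕ} {t : ℝ} (ht : 0 < t) :
    (volume : Measure (Cn n)) ≪ gaussianMeasure n t := by
  refine withDensity_absolutelyContinuous' ?_ ?_
  · exact continuous_gaussianDensity.measurable.ennreal_ofReal.aemeasurable
  · exact Filter.Eventually.of_forall fun z => by
      simpa using gaussianDensity_pos ht z

theorem gaussian_ac {n : ℕ} {s t : ℝ} (ht : 0 < t) :
    gaussianMeasure n s ≪ gaussianMeasure n t :=
  (withDensity_absolutelyContinuous _ _).trans (volume_ac ht)

theorem integrable_exp_sqNorm {n : ℕ} {b : ℝ} (hb : 0 < b) :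
    Integrable (fun z : Cn n => Real.exp (-b * sqNorm z)) := by
  have h1 : Integrable (fun z : ℂ => Real.exp (-b * ‖z‖ ^ 2)) := by
    have := (GaussianFourier.integrable_cexp_neg_mul_sq_norm_add (V := ℂ) (b := (b : ℂ))
      (by simpa using hb) 0 0).norm
    refine this.congr (Filter.Eventually.of_forall fun z => ?_)
    simp only [zero_mul, add_zero, Complex.norm_exp]
    norm_cast
  have h2 := Integrable.fintype_prod (ι := Fin n) (μ := fun _ => (volume : Measure ℂ))
    (f := fun _ z => Real.exp (-b * ‖z‖ ^ 2)) (fun _ => h1)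
  refine h2.congr (Filter.Eventually.of_forall fun z => ?_)
  simp only [sqNorm, Finset.mul_sum, Real.exp_sum]

/-- Young's inequality for convolution with a kernel. -/
theorem lintegral_young {n : ℕ} {p : ℝ} (hp : 1 < p) {K G : Cn n → ℝ≥0∞}
    (hK : Measurable K) (hG : AEMeasurable G) :
    ∫⁻ z, (∫⁻ w, K (z - w) * G w) ^ p ≤ (∫⁻ w, K w) ^ p * ∫⁻ w, G w ^ p := by
  have hp0 : 0 < p := by linarith
  have hpq := Real.HolderConjugate.conjExponent hp
  set q := p.conjExponent with hq
  have hq0 : 0 < q := hpq.symm.pos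
  have key : ∀ z, (∫⁻ w, K (z - w) * G w) ^ p ≤
      (∫⁻ w, K w) ^ (p / q) * ∫⁻ w, K (z - w) * G w ^ p := by
    intro z
    have hKz : Measurable fun w => K (z - w) := hK.comp (measurable_const.sub measurable_id)
    have h1 := ENNReal.lintegral_mul_le_Lp_mul_Lq volume hpq.symm
      (f := fun w => K (z - w) ^ (1 / q)) (g := fun w => K (z - w) ^ (1 / p) * G w)
      (hKz.pow_const _).aemeasurable ((hKz.pow_const _).aemeasurable.mul hG)
    have h2 : ∀ w, ((fun w => K (z - w) ^ (1 / q)) * fun w => K (z - w) ^ (1 / p) * G w) w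
        = K (z - w) * G w := by
      intro w
      simp only [Pi.mul_apply]
      rw [← mul_assoc, ← ENNReal.rpow_add_of_nonneg _ _ (by positivity) (by positivity)]
      have : 1 / q + 1 / p = 1 := by
        have := hpq.inv_add_inv_eq_one
        rw [one_div, one_div, add_comm]; exact this
      rw [this, ENNReal.rpow_one]
    simp only [h2] at h1
    have h3 : ∀ w, (K (z - w) ^ (1 / q)) ^ q = K (z - w) := by
      intro w; rw [← ENNReal.rpow_mul, one_div_mul_cancel hq0.ne', ENNReal.rpow_one]
    have h4 : ∀ w, (K (z - w) ^ (1 / p) * G w) ^ p = K (z - w) * G w ^ p := by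
      intro w
      rw [ENNReal.mul_rpow_of_nonneg _ _ hp0.le, ← ENNReal.rpow_mul,
        one_div_mul_cancel hp0.ne', ENNReal.rpow_one]
    simp only [h3, h4] at h1
    rw [lintegral_sub_left_eq_self (fun w => K w) z] at h1
    calc _ ≤ _ := ENNReal.rpow_le_rpow h1 hp0.le
      _ = _ := by
        rw [ENNReal.mul_rpow_of_nonneg _ _ hp0.le, ← ENNReal.rpow_mul, ← ENNReal.rpow_mul,
          one_div_mul_cancel hp0.ne', ENNReal.rpow_one, one_div_mul_eq_div]
  have hmeas : AEMeasurable (Function.uncurry fun (z w : Cn n) => K (z - w) * G w ^ p)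
      (volume.prod volume) :=
    (hK.comp (measurable_fst.sub measurable_snd)).aemeasurable.mul
      ((hG.pow_const p).comp_quasiMeasurePreserving Measure.quasiMeasurePreserving_snd)
  calc _ ≤ ∫⁻ z, (∫⁻ w, K w) ^ (p / q) * ∫⁻ w, K (z - w) * G w ^ p := lintegral_mono key
    _ = (∫⁻ w, K w) ^ (p / q) * ∫⁻ z, ∫⁻ w, K (z - w) * G w ^ p := by
        exact lintegral_const_mul'' _ hmeas.lintegral_prod_right'
    _ = (∫⁻ w, K w) ^ (p / q) * ((∫⁻ w, K w) * ∫⁻ w, G w ^ p) := by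
        congr 1
        rw [lintegral_lintegral_swap hmeas]
        have : ∀ w, ∫⁻ z, K (z - w) * G w ^ p = (∫⁻ w, K w) * G w ^ p := by
          intro w
          have hm : Measurable fun z => K (z - w) := hK.comp (measurable_id.sub measurable_const)
          rw [lintegral_mul_const _ hm, lintegral_sub_right_eq_self (fun w => K w) w]
        simp only [this]
        rw [lintegral_const_mul'' _ (hG.pow_const p)]
    _ = _ := by
        rw [← mul_assoc]
        congr 1
        nth_rewrite 2 [← ENNReal.rpow_one (∫⁻ w, K w)]
        rw [← ENNReal.rpow_add_of_nonneg _ _ (by positivity) zero_le_one]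
        congr 1
        have := hpq.inv_add_inv_eq_one
        field_simp at this ⊢
        linarith

/-- `P_t F (z) = ∫ exp (z ⬝ conj w / t) F(w) dμ_t(w)`. -/
def fockProj {n : ℕ} (t : ℝ) (F : Cn n → ℂ) (z : Cn n) : ℂ :=
  ∫ w, Complex.exp (herm z w / t) * F w ∂gaussianMeasure n t

/-- `|F(w)| exp (-|w|² / (2t))`, whose `L^p` norm for Lebesgue measure is, up to a constant, the
norm of `F` in `L^p(ℂⁿ, μ_{2t/p})`. -/
def weighted {n : ℕ} (t : ℝ) (F : Cn n → ℂ) (w : Cn n) : ℝ≥0∞ :=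
  ‖F w‖ₑ * ENNReal.ofReal (Real.exp (-(sqNorm w) / (2 * t)))

theorem lintegral_gaussian {n : ℕ} {t : ℝ} (H : Cn n → ℝ≥0∞) :
    ∫⁻ w, H w ∂gaussianMeasure n t =
      ∫⁻ w, ENNReal.ofReal (gaussianDensity n t w) * H w := by
  unfold gaussianMeasure
  rw [lintegral_withDensity_eq_lintegral_mul_non_measurable _
    continuous_gaussianDensity.measurable.ennreal_ofReal
    (Filter.Eventually.of_forall fun _ => ENNReal.ofReal_lt_top)]
  rfl

theorem lintegral_rpow_eq {n : ℕ} {t p : ℝ} (ht : 0 < t) (hp : 1 < p) (F : Cn n → ℂ) :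
    ∫⁻ w, ‖F w‖ₑ ^ p ∂gaussianMeasure n (2 * t / p) =
      ENNReal.ofReal (1 / (Real.pi * (2 * t / p)) ^ n) * ∫⁻ w, weighted t F w ^ p := by
  have hp0 : 0 < p := by linarith
  rw [lintegral_gaussian, ← lintegral_const_mul' _ _ ENNReal.ofReal_ne_top]
  refine lintegral_congr fun w => ?_
  have hpi := Real.pi_pos
  unfold gaussianDensity weighted
  rw [ENNReal.ofReal_mul (by positivity), mul_assoc, ENNReal.mul_rpow_of_nonneg _ _ hp0.le,
    ENNReal.ofReal_rpow_of_nonneg (by positivity) hp0.le, ← Real.exp_mul]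
  congr 1
  rw [mul_comm]
  congr 4
  field_simp

theorem weighted_aemeasurable {n : ℕ} {t : ℝ} {F : Cn n → ℂ}
    (hF : AEStronglyMeasurable F volume) : AEMeasurable (weighted t F) := by
  unfold weighted
  have : Measurable fun w : Cn n => ENNReal.ofReal (Real.exp (-(sqNorm w) / (2 * t))) := by
    have := @continuous_sqNorm n
    exact (by fun_prop : Continuous fun w : Cn n =>
      Real.exp (-(sqNorm w) / (2 * t))).measurable.ennreal_ofReal
  exact hF.enorm.mul this.aemeasurable

theorem eLpNorm_eq {n : ℕ} {t p : ℝ} (ht : 0 < t) (hp : 1 < p) (F : Cn n → ℂ) :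
    eLpNorm F (ENNReal.ofReal p) (gaussianMeasure n (2 * t / p)) =
      (ENNReal.ofReal (1 / (Real.pi * (2 * t / p)) ^ n) * ∫⁻ w, weighted t F w ^ p) ^ (1 / p) := by
  have hp0 : 0 < p := by linarith
  rw [eLpNorm_eq_lintegral_rpow_enorm_toReal (by simpa using hp0) ENNReal.ofReal_ne_top,
    ENNReal.toReal_ofReal hp0.le, lintegral_rpow_eq ht hp]

theorem norm_le_sqNorm {n : ℕ} (w : Cn n) : ‖w‖ ^ 2 ≤ sqNorm w := by
  have h : ‖w‖ ≤ Real.sqrt (sqNorm w) := by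
    refine (pi_norm_le_iff_of_nonneg (Real.sqrt_nonneg _)).2 fun i => Real.le_sqrt_of_sq_le ?_
    exact Finset.single_le_sum (f := fun i => ‖w i‖ ^ 2) (fun _ _ => sq_nonneg _)
      (Finset.mem_univ i)
  have h0 : 0 ≤ sqNorm w := Finset.sum_nonneg fun _ _ => sq_nonneg _
  calc ‖w‖ ^ 2 ≤ Real.sqrt (sqNorm w) ^ 2 := by gcongr
    _ = _ := Real.sq_sqrt h0

theorem lintegral_weighted_lt_top {n : ℕ} {t p : ℝ} (ht : 0 < t) (hp : 1 < p) {F : Cn n → ℂ}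
    (hF : MemLp F (ENNReal.ofReal p) (gaussianMeasure n (2 * t / p))) :
    ∫⁻ w, weighted t F w ^ p < ∞ := by
  have hp0 : 0 < p := by linarith
  have h := hF.2
  rw [eLpNorm_eq ht hp] at h
  have h1 := (ENNReal.rpow_lt_top_iff_of_pos (by positivity)).1 h
  have hpi := Real.pi_pos
  refine (ENNReal.mul_lt_top_iff.1 h1).elim (fun h => h.2) fun h => ?_
  rcases h with h | h
  · exact absurd h (by simp; positivity)
  · rw [h]; simp

theorem aesm_volume {n : ℕ} {t p : ℝ} (ht : 0 < t) (hp : 1 < p) {F : Cn n → ℂ}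
    (hF : MemLp F (ENNReal.ofReal p) (gaussianMeasure n (2 * t / p))) :
    AEStronglyMeasurable F volume :=
  hF.1.mono_ac (volume_ac (by have : 0 < p := by linarith
                              positivity))

theorem integrable_exp_mul {n : ℕ} {t p : ℝ} (ht : 0 < t) (hp : 1 < p) {F : Cn n → ℂ}
    (hF : MemLp F (ENNReal.ofReal p) (gaussianMeasure n (2 * t / p))) (a : ℝ) :
    Integrable (fun w => Real.exp (a * ‖w‖) * ‖F w‖) (gaussianMeasure n t) := by
  have hv := aesm_volume ht hp hF
  have hpi := Real.pi_pos
  refine ⟨AEStronglyMeasurable.mul (by fun_prop)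
    (hv.mono_ac (withDensity_absolutelyContinuous _ _)).norm, ?_⟩
  have hpq := Real.HolderConjugate.conjExponent hp
  set q := p.conjExponent with hq
  have hq0 : 0 < q := hpq.symm.pos
  unfold HasFiniteIntegral
  rw [lintegral_gaussian]
  set D : ℝ := 1 / (Real.pi * t) ^ n * Real.exp (a ^ 2 * t) with hD
  have hle : ∀ w : Cn n, ENNReal.ofReal (gaussianDensity n t w) *
      ‖Real.exp (a * ‖w‖) * ‖F w‖‖ₑ ≤
      weighted t F w * ENNReal.ofReal (D * Real.exp (-(1 / (4 * t)) * sqNorm w)) := by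
    intro w
    unfold weighted
    rw [enorm_mul, enorm_norm, mul_assoc, ← ENNReal.ofReal_mul (by positivity), ← mul_assoc,
      mul_comm, Real.enorm_eq_ofReal (by positivity),
      ← ENNReal.ofReal_mul (gaussianDensity_pos ht w).le]
    refine mul_le_mul' le_rfl (ENNReal.ofReal_le_ofReal ?_)
    unfold gaussianDensity
    rw [hD]
    have h1 : a * ‖w‖ ≤ a ^ 2 * t + 1 / (4 * t) * sqNorm w := by
      have h2 : a * ‖w‖ ≤ a ^ 2 * t + 1 / (4 * t) * ‖w‖ ^ 2 := by
        have h3 : a ^ 2 * t + 1 / (4 * t) * ‖w‖ ^ 2 - a * ‖w‖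
          = (2 * a * t - ‖w‖) ^ 2 / (4 * t) := by field_simp; ring
        have h4 : 0 ≤ (2 * a * t - ‖w‖) ^ 2 / (4 * t) := by positivity
        linarith
      have := norm_le_sqNorm w
      have h5 : 1 / (4 * t) * ‖w‖ ^ 2 ≤ 1 / (4 * t) * sqNorm w := by gcongr
      linarith
    have h6 : Real.exp (-(sqNorm w) / t) * Real.exp (a * ‖w‖) ≤
        Real.exp (-(sqNorm w) / (2 * t)) *
          (Real.exp (a ^ 2 * t) * Real.exp (-(1 / (4 * t)) * sqNorm w)) := by
      rw [← Real.exp_add, ← Real.exp_add, ← Real.exp_add]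
      apply Real.exp_le_exp.2
      have e1 : -(sqNorm w) / t = -(sqNorm w) / (2 * t) - 2 * (1 / (4 * t) * sqNorm w) := by
        field_simp; ring
      rw [e1]; linarith
    calc _ = 1 / (Real.pi * t) ^ n * (Real.exp (-(sqNorm w) / t) * Real.exp (a * ‖w‖)) := by ring
      _ ≤ 1 / (Real.pi * t) ^ n * (Real.exp (-(sqNorm w) / (2 * t)) *
          (Real.exp (a ^ 2 * t) * Real.exp (-(1 / (4 * t)) * sqNorm w))) := by gcongr
      _ = _ := by ring
  refine (lintegral_mono hle).trans_lt ?_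
  have hmeas : Measurable fun w : Cn n =>
      ENNReal.ofReal (D * Real.exp (-(1 / (4 * t)) * sqNorm w)) := by
    have := @continuous_sqNorm n
    exact (by fun_prop : Continuous fun w : Cn n =>
      D * Real.exp (-(1 / (4 * t)) * sqNorm w)).measurable.ennreal_ofReal
  refine (ENNReal.lintegral_mul_le_Lp_mul_Lq volume hpq (weighted_aemeasurable hv)
    hmeas.aemeasurable).trans_lt ?_
  refine ENNReal.mul_lt_top (ENNReal.rpow_lt_top_of_nonneg (by have := hpq.pos; positivity)
    (lintegral_weighted_lt_top ht hp hF).ne)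
    (ENNReal.rpow_lt_top_of_nonneg (by positivity) ?_)
  have hD0 : 0 ≤ D := by positivity
  have : ∀ w : Cn n, ENNReal.ofReal (D * Real.exp (-(1 / (4 * t)) * sqNorm w)) ^ q =
      ENNReal.ofReal (D ^ q * Real.exp (-(q / (4 * t)) * sqNorm w)) := by
    intro w
    rw [ENNReal.ofReal_rpow_of_nonneg (by positivity) hq0.le,
      Real.mul_rpow hD0 (Real.exp_pos _).le, ← Real.exp_mul]
    congr 3
    field_simp
  simp only [this]
  have hint : Integrable (fun w : Cn n => D ^ q * Real.exp (-(q / (4 * t)) * sqNorm w)) :=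
    (integrable_exp_sqNorm (by positivity)).const_mul _
  exact hint.lintegral_lt_top.ne

theorem enorm_fockProj_le {n : ℕ} {t : ℝ} (ht : 0 < t) (F : Cn n → ℂ) (z : Cn n) :
    weighted t (fockProj t F) z ≤ ENNReal.ofReal (1 / (Real.pi * t) ^ n) *
      ∫⁻ w, ENNReal.ofReal (Real.exp (-(1 / (2 * t)) * sqNorm (z - w))) * weighted t F w := by
  have hpi := Real.pi_pos
  have h1 : ‖fockProj t F z‖ₑ ≤ _ := enorm_integral_le_lintegral_enorm _
  rw [lintegral_gaussian] at h1
  unfold weighted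
  refine (mul_le_mul_left h1 _).trans ?_
  rw [← lintegral_mul_const' _ _ ENNReal.ofReal_ne_top,
    ← lintegral_const_mul' _ _ ENNReal.ofReal_ne_top]
  refine lintegral_mono fun w => le_of_eq ?_
  have e1 : ‖Complex.exp (herm z w / t)‖ₑ = ENNReal.ofReal (Real.exp ((herm z w).re / t)) := by
    rw [← ofReal_norm, Complex.norm_exp, Complex.div_ofReal_re]
  have e2 : gaussianDensity n t w * Real.exp ((herm z w).re / t) *
      Real.exp (-(sqNorm z) / (2 * t)) = 1 / (Real.pi * t) ^ n *
      Real.exp (-(1 / (2 * t)) * sqNorm (z - w)) * Real.exp (-(sqNorm w) / (2 * t)) := by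
    unfold gaussianDensity
    simp only [mul_assoc, ← Real.exp_add]
    congr 2
    rw [sqNorm_sub]
    field_simp
    ring
  have e3 := congrArg ENNReal.ofReal e2
  rw [ENNReal.ofReal_mul (by have := gaussianDensity_pos ht w; positivity),
    ENNReal.ofReal_mul (gaussianDensity_pos ht w).le, ENNReal.ofReal_mul (by positivity),
    ENNReal.ofReal_mul (by positivity)] at e3
  rw [enorm_mul, e1]
  calc _ = (ENNReal.ofReal (gaussianDensity n t w) * ENNReal.ofReal (Real.exp ((herm z w).re / t))
        * ENNReal.ofReal (Real.exp (-(sqNorm z) / (2 * t)))) * ‖F w‖ₑ := by ring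
    _ = _ := by rw [e3]; ring

theorem eLpNorm_fockProj_le {n : ℕ} {t p : ℝ} (ht : 0 < t) (hp : 1 < p) {F : Cn n → ℂ}
    (hF : MemLp F (ENNReal.ofReal p) (gaussianMeasure n (2 * t / p))) :
    eLpNorm (fockProj t F) (ENNReal.ofReal p) (gaussianMeasure n (2 * t / p)) ≤
      (ENNReal.ofReal (1 / (Real.pi * t) ^ n) *
        ∫⁻ w : Cn n, ENNReal.ofReal (Real.exp (-(1 / (2 * t)) * sqNorm w))) *
      eLpNorm F (ENNReal.ofReal p) (gaussianMeasure n (2 * t / p)) := by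
  have hp0 : 0 < p := by linarith
  have hK : Measurable fun w : Cn n =>
      ENNReal.ofReal (Real.exp (-(1 / (2 * t)) * sqNorm w)) := by
    have := @continuous_sqNorm n
    exact (by fun_prop : Continuous fun w : Cn n =>
      Real.exp (-(1 / (2 * t)) * sqNorm w)).measurable.ennreal_ofReal
  rw [eLpNorm_eq ht hp, eLpNorm_eq ht hp]
  set K := ∫⁻ w : Cn n, ENNReal.ofReal (Real.exp (-(1 / (2 * t)) * sqNorm w)) with hKdef
  set c := ENNReal.ofReal (1 / (Real.pi * t) ^ n)
  have h1 : ∫⁻ w, weighted t (fockProj t F) w ^ p ≤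
      c ^ p * (K ^ p * ∫⁻ w, weighted t F w ^ p) := by
    calc _ ≤ ∫⁻ z, (c * ∫⁻ w, ENNReal.ofReal (Real.exp (-(1 / (2 * t)) * sqNorm (z - w))) *
          weighted t F w) ^ p :=
          lintegral_mono fun z => ENNReal.rpow_le_rpow (enorm_fockProj_le ht F z) hp0.le
      _ = c ^ p * ∫⁻ z, (∫⁻ w, ENNReal.ofReal (Real.exp (-(1 / (2 * t)) * sqNorm (z - w))) *
          weighted t F w) ^ p := by
          simp only [ENNReal.mul_rpow_of_nonneg _ _ hp0.le]
          exact lintegral_const_mul' _ _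
            (ENNReal.rpow_lt_top_of_nonneg hp0.le ENNReal.ofReal_ne_top).ne
      _ ≤ _ := mul_le_mul_right
          (lintegral_young hp hK (weighted_aemeasurable (aesm_volume ht hp hF))) _
  calc _ ≤ (ENNReal.ofReal (1 / (Real.pi * (2 * t / p)) ^ n) *
        (c ^ p * (K ^ p * ∫⁻ w, weighted t F w ^ p))) ^ (1 / p) := by gcongr
    _ = ((c * K) ^ p * (ENNReal.ofReal (1 / (Real.pi * (2 * t / p)) ^ n) *
        ∫⁻ w, weighted t F w ^ p)) ^ (1 / p) := by
        rw [ENNReal.mul_rpow_of_nonneg _ _ hp0.le]; ring_nf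
    _ = _ := by
        rw [ENNReal.mul_rpow_of_nonneg _ _ (by positivity), ← ENNReal.rpow_mul,
          mul_one_div_cancel hp0.ne', ENNReal.rpow_one]

theorem norm_herm_le {n : ℕ} (z w : Cn n) : ‖herm z w‖ ≤ n * ‖z‖ * ‖w‖ := by
  unfold herm
  refine (norm_sum_le _ _).trans ?_
  refine (Finset.sum_le_card_nsmul _ _ (‖z‖ * ‖w‖) fun i _ => ?_).trans (by simp [mul_assoc])
  rw [norm_mul, RCLike.norm_conj]
  exact mul_le_mul (norm_le_pi_norm z i) (norm_le_pi_norm w i) (norm_nonneg _) (norm_nonneg _)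

theorem continuous_herm_left {n : ℕ} (z : Cn n) : Continuous fun w : Cn n => herm z w := by
  unfold herm; fun_prop

theorem integrable_kernel {n : ℕ} {t p : ℝ} (ht : 0 < t) (hp : 1 < p) {F : Cn n → ℂ}
    (hF : MemLp F (ENNReal.ofReal p) (gaussianMeasure n (2 * t / p))) (z : Cn n) :
    Integrable (fun w => Complex.exp (herm z w / t) * F w) (gaussianMeasure n t) := by
  have hv := (aesm_volume ht hp hF).mono_ac (withDensity_absolutelyContinuous _
    (fun z => ENNReal.ofReal (gaussianDensity n t z)))
  refine (integrable_exp_mul ht hp hF (n * ‖z‖ / t)).mono'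
    (AEStronglyMeasurable.mul ?_ hv) (Filter.Eventually.of_forall fun w => ?_)
  · have := continuous_herm_left z
    exact (by fun_prop : Continuous fun w : Cn n =>
      Complex.exp (herm z w / t)).aestronglyMeasurable
  · rw [norm_mul, Complex.norm_exp, Complex.div_ofReal_re]
    gcongr
    rw [div_mul_eq_mul_div]
    gcongr
    exact (Complex.re_le_norm _).trans (norm_herm_le z w)

/-- The linear functional `z ↦ z ⬝ conj w`. -/
def hermL {n : ℕ} (w : Cn n) : Cn n →L[ℂ] ℂ :=
  ∑ i, (starRingEnd ℂ) (w i) • (ContinuousLinearMap.proj i : Cn n →L[ℂ] ℂ)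

theorem hermL_apply {n : ℕ} (z w : Cn n) : hermL w z = herm z w := by
  simp [hermL, herm, mul_comm]

theorem norm_hermL_le {n : ℕ} (w : Cn n) : ‖hermL w‖ ≤ n * ‖w‖ := by
  refine ContinuousLinearMap.opNorm_le_bound _ (by positivity) fun z => ?_
  rw [hermL_apply]
  calc _ ≤ _ := norm_herm_le z w
    _ = _ := by ring

theorem continuous_hermL {n : ℕ} : Continuous (hermL : Cn n → (Cn n →L[ℂ] ℂ)) := by
  unfold hermL
  fun_prop

theorem differentiable_fockProj {n : ℕ} {t p : ℝ} (ht : 0 < t) (hp : 1 < p) {F : Cn n → ℂ}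
    (hF : MemLp F (ENNReal.ofReal p) (gaussianMeasure n (2 * t / p))) :
    Differentiable ℂ (fockProj t F) := by
  intro z₀
  have hv := (aesm_volume ht hp hF).mono_ac (withDensity_absolutelyContinuous _
    (fun z => ENNReal.ofReal (gaussianDensity n t z)))
  have hexp : ∀ z : Cn n, Continuous fun w : Cn n => Complex.exp (herm z w / t) := fun z => by
    have := continuous_herm_left z
    fun_prop
  refine (hasFDerivAt_integral_of_dominated_of_fderiv_le (𝕜 := ℂ) (μ := gaussianMeasure n t)
    (F := fun z w => Complex.exp (herm z w / t) * F w)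
    (F' := fun z w => (Complex.exp (herm z w / t) * F w / t) • hermL w)
    (s := Metric.ball z₀ 1) (x₀ := z₀)
    (bound := fun w => n / t * (Real.exp ((n * (‖z₀‖ + 1) / t + 1) * ‖w‖) * ‖F w‖))
    (Metric.ball_mem_nhds _ one_pos)
    (Filter.Eventually.of_forall fun z => (integrable_kernel ht hp hF z).1)
    (integrable_kernel ht hp hF z₀) ?_ ?_
    ((integrable_exp_mul ht hp hF _).const_mul _) ?_).differentiableAt
  · have h1 : AEStronglyMeasurable (fun w => Complex.exp (herm z₀ w / t) * F w / t)
        (gaussianMeasure n t) := by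
      simp only [div_eq_mul_inv _ (t : ℂ)]
      exact (integrable_kernel ht hp hF z₀).1.mul_const _
    exact h1.smul continuous_hermL.aestronglyMeasurable
  · refine Filter.Eventually.of_forall fun w z hz => ?_
    have hz1 : ‖z‖ ≤ ‖z₀‖ + 1 := by
      have := norm_sub_norm_le z z₀
      have h2 : ‖z - z₀‖ < 1 := by simpa [dist_eq_norm] using hz
      linarith
    have hw : ‖w‖ ≤ Real.exp ‖w‖ := by
      have := Real.add_one_le_exp ‖w‖; linarith
    rw [norm_smul, norm_div, norm_mul, Complex.norm_exp, Complex.div_ofReal_re,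
      Complex.norm_real, Real.norm_of_nonneg ht.le]
    have h1 : Real.exp ((herm z w).re / t) ≤ Real.exp (n * (‖z₀‖ + 1) / t * ‖w‖) := by
      gcongr
      rw [div_mul_eq_mul_div]
      gcongr
      calc _ ≤ _ := (Complex.re_le_norm _).trans (norm_herm_le z w)
        _ ≤ _ := by gcongr
    calc _ ≤ Real.exp (n * (‖z₀‖ + 1) / t * ‖w‖) * ‖F w‖ / t * (n * Real.exp ‖w‖) := by
          gcongr
          exact (norm_hermL_le w).trans (by gcongr)
      _ = _ := by rw [add_mul, Real.exp_add, one_mul]; ring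
  · refine Filter.Eventually.of_forall fun w z _ => ?_
    have h1 : HasFDerivAt (fun z : Cn n => herm z w / t) ((t : ℂ)⁻¹ • hermL w) z := by
      have := ((hermL w).hasFDerivAt (x := z)).const_smul ((t : ℂ)⁻¹)
      refine this.congr_of_eventuallyEq (Filter.Eventually.of_forall fun y => ?_)
      simp [hermL_apply, div_eq_inv_mul]
    have h2 := h1.cexp.mul_const (F w)
    refine h2.congr_fderiv ?_
    simp only [smul_smul]
    congr 1
    rw [div_eq_mul_inv]
    ring

theorem memLp_fockProj {n : ℕ} {t p : ℝ} (ht : 0 < t) (hp : 1 < p) {F : Cn n → ℂ}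
    (hF : MemLp F (ENNReal.ofReal p) (gaussianMeasure n (2 * t / p))) :
    MemLp (fockProj t F) (ENNReal.ofReal p) (gaussianMeasure n (2 * t / p)) := by
  refine ⟨(differentiable_fockProj ht hp hF).continuous.aestronglyMeasurable,
    (eLpNorm_fockProj_le ht hp hF).trans_lt (ENNReal.mul_lt_top (ENNReal.mul_lt_top
      ENNReal.ofReal_lt_top ?_) hF.2)⟩
  exact (integrable_exp_sqNorm (by positivity)).lintegral_lt_top

/-- The admissible exponents `1 < p < ∞`. -/
abbrev Exponent : Type := Set.Ioi (1 : ℝ)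

instance factOneLe (p : Exponent) : Fact (1 ≤ ENNReal.ofReal (p : ℝ)) :=
  ⟨by rw [ENNReal.one_le_ofReal]; exact (Set.mem_Ioi.1 p.2).le⟩

/-- The space `L^p(ℂⁿ, μ_{2t/p})`. -/
abbrev WeightedLp (n : ℕ) (t : ℝ) (p : Exponent) : Type :=
  Lp ℂ (ENNReal.ofReal (p : ℝ)) (gaussianMeasure n (2 * t / p))

/-- `L^p(ℂⁿ, μ_{2t/p}) ∩ Hol(ℂⁿ)`, as a linear subspace of `L^p(ℂⁿ, μ_{2t/p})`. -/
def fockSubmodule (n : ℕ) (t : ℝ) (p : Exponent) : Submodule ℂ (WeightedLp n t p) where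
  carrier := {f | ∃ F : Cn n → ℂ, Differentiable ℂ F ∧ f =ᵐ[gaussianMeasure n (2 * t / p)] F}
  zero_mem' := ⟨fun _ => 0, differentiable_const 0, Lp.coeFn_zero _ _ _⟩
  add_mem' := by
    rintro f g ⟨F, hF, hf⟩ ⟨G, hG, hg⟩
    exact ⟨F + G, hF.add hG, (Lp.coeFn_add f g).trans (hf.add hg)⟩
  smul_mem' := by
    rintro c f ⟨F, hF, hf⟩
    exact ⟨c • F, hF.const_smul c, (Lp.coeFn_smul c f).trans (hf.const_smul c)⟩

/-- The Fock space `F_t^p`, with the norm of `L^p(ℂⁿ, μ_{2t/p})`. -/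
def FockSpace (n : ℕ) (t : ℝ) (p : Exponent) : Type := fockSubmodule n t p

instance FockSpace.instNormedAddCommGroup (n : ℕ) (t : ℝ) (p : Exponent) :
    NormedAddCommGroup (FockSpace n t p) :=
  inferInstanceAs (NormedAddCommGroup (fockSubmodule n t p))

instance FockSpace.instNormedSpace (n : ℕ) (t : ℝ) (p : Exponent) :
    NormedSpace ℂ (FockSpace n t p) :=
  inferInstanceAs (NormedSpace ℂ (fockSubmodule n t p))

/-- The inclusion of `F_t^p` into `L^p(ℂⁿ, μ_{2t/p})`. -/
def FockSpace.toLp {n : ℕ} {t : ℝ} {p : Exponent} : FockSpace n t p →ₗᵢ[ℂ] WeightedLp n t p :=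
  (fockSubmodule n t p).subtypeₗᵢ

/-- The bounded linear operators on `F_t^p`. -/
abbrev FockOp (n : ℕ) (t : ℝ) (p : Exponent) : Type := FockSpace n t p →L[ℂ] FockSpace n t p

theorem norm_symbol_mul_le {n : ℕ} {t : ℝ} {p : Exponent} (f : Cn n →ᵇ ℂ)
    (g : WeightedLp n t p) :
    ∀ᵐ w ∂gaussianMeasure n (2 * t / p), ‖f w * g w‖ ≤ ‖f‖ * ‖g w‖ :=
  Filter.Eventually.of_forall fun w => by
    rw [norm_mul]; gcongr; exact f.norm_coe_le_norm w

theorem memLp_symbol_mul {n : ℕ} {t : ℝ} {p : Exponent} (f : Cn n →ᵇ ℂ)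
    (g : WeightedLp n t p) :
    MemLp (fun w => f w * g w) (ENNReal.ofReal (p : ℝ)) (gaussianMeasure n (2 * t / p)) :=
  (Lp.memLp g).of_le_mul
    (f.continuous.aestronglyMeasurable.mul (Lp.memLp g).1) (norm_symbol_mul_le f g)

theorem ae_of_ae_weight {n : ℕ} {t : ℝ} (ht : 0 < t) {p : Exponent} {q : Cn n → Prop}
    (h : ∀ᵐ w ∂gaussianMeasure n (2 * t / p), q w) : ∀ᵐ w ∂gaussianMeasure n t, q w :=
  (gaussian_ac (by have : (0 : ℝ) < p := one_pos.trans p.2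
                   positivity)).ae_le h

/-- An upper bound for the norm of the projection `P_t` on `L^p(ℂⁿ, μ_{2t/p})`. -/
def projBound (n : ℕ) (t : ℝ) : ℝ≥0∞ :=
  ENNReal.ofReal (1 / (Real.pi * t) ^ n) *
    ∫⁻ w : Cn n, ENNReal.ofReal (Real.exp (-(1 / (2 * t)) * sqNorm w))

theorem projBound_ne_top {n : ℕ} {t : ℝ} (ht : 0 < t) : projBound n t ≠ ∞ :=
  ENNReal.mul_ne_top ENNReal.ofReal_ne_top
    (integrable_exp_sqNorm (by positivity)).lintegral_lt_top.ne

theorem Exponent.one_lt (p : Exponent) : (1 : ℝ) < p := p.2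

theorem memLp_toeplitz {n : ℕ} {t : ℝ} (ht : 0 < t) (p : Exponent) (f : Cn n →ᵇ ℂ)
    (g : WeightedLp n t p) :
    MemLp (fockProj t fun w => f w * g w) (ENNReal.ofReal (p : ℝ))
      (gaussianMeasure n (2 * t / p)) :=
  memLp_fockProj ht p.one_lt (memLp_symbol_mul f g)

theorem fockProj_add {n : ℕ} {t : ℝ} (ht : 0 < t) {p : Exponent} (f : Cn n →ᵇ ℂ)
    (g h : WeightedLp n t p) :
    (fockProj t fun w => f w * (g + h : WeightedLp n t p) w) =
      (fockProj t fun w => f w * g w) + fockProj t fun w => f w * h w := by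
  funext z
  rw [Pi.add_apply]
  unfold fockProj
  rw [← integral_add (integrable_kernel ht p.one_lt (memLp_symbol_mul f g) z)
    (integrable_kernel ht p.one_lt (memLp_symbol_mul f h) z)]
  refine integral_congr_ae ?_
  filter_upwards [ae_of_ae_weight ht (Lp.coeFn_add g h)] with w hw
  rw [hw, Pi.add_apply]
  ring

theorem fockProj_smul {n : ℕ} {t : ℝ} (ht : 0 < t) {p : Exponent} (f : Cn n →ᵇ ℂ)
    (c : ℂ) (g : WeightedLp n t p) :
    (fockProj t fun w => f w * (c • g : WeightedLp n t p) w) =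
      c • fockProj t fun w => f w * g w := by
  funext z
  rw [Pi.smul_apply]
  unfold fockProj
  rw [← integral_smul]
  refine integral_congr_ae ?_
  filter_upwards [ae_of_ae_weight ht (Lp.coeFn_smul c g)] with w hw
  rw [hw, Pi.smul_apply, smul_eq_mul, smul_eq_mul]
  ring

theorem norm_toeplitz_le {n : ℕ} {t : ℝ} (ht : 0 < t) (p : Exponent) (f : Cn n →ᵇ ℂ)
    (g : WeightedLp n t p) :
    ‖(memLp_toeplitz ht p f g).toLp _‖ ≤ (projBound n t).toReal * ‖f‖ * ‖g‖ := by
  have h2 : eLpNorm (fun w => f w * g w) (ENNReal.ofReal (p : ℝ))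
      (gaussianMeasure n (2 * t / p)) ≤ ENNReal.ofReal ‖f‖ *
      eLpNorm g (ENNReal.ofReal (p : ℝ)) (gaussianMeasure n (2 * t / p)) :=
    eLpNorm_le_mul_eLpNorm_of_ae_le_mul (norm_symbol_mul_le f g) _
  have h3 := (eLpNorm_fockProj_le ht p.one_lt (memLp_symbol_mul f g)).trans
    (mul_le_mul' le_rfl h2)
  have h4 := ENNReal.toReal_mono (ENNReal.mul_ne_top (projBound_ne_top ht)
    (ENNReal.mul_ne_top ENNReal.ofReal_ne_top (Lp.eLpNorm_ne_top g))) h3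
  rw [Lp.norm_toLp, Lp.norm_def]
  refine h4.trans (le_of_eq ?_)
  rw [ENNReal.toReal_mul, ENNReal.toReal_mul, ENNReal.toReal_ofReal (norm_nonneg f), mul_assoc]

/-- The Toeplitz operator `T_f^t g = P_t (f g)` on `F_t^p` with bounded continuous symbol `f`. -/
def toeplitz {n : ℕ} {t : ℝ} (ht : 0 < t) (p : Exponent) (f : Cn n →ᵇ ℂ) : FockOp n t p :=
  LinearMap.mkContinuous
    { toFun := fun g =>
        ⟨(memLp_toeplitz ht p f g.toLp).toLp (fockProj t fun w => f w * g.toLp w),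
          fockProj t fun w => f w * g.toLp w,
          differentiable_fockProj ht p.one_lt (memLp_symbol_mul f g.toLp),
          MemLp.coeFn_toLp _⟩
      map_add' := fun g h => Subtype.ext <| by
        refine Eq.trans ?_ (MemLp.toLp_add (memLp_toeplitz ht p f g.toLp)
          (memLp_toeplitz ht p f h.toLp))
        refine MemLp.toLp_congr (memLp_toeplitz ht p f (g + h).toLp) _
          (Filter.Eventually.of_forall fun z => ?_)
        rw [map_add, fockProj_add ht]
      map_smul' := fun c g => Subtype.ext <| by
        refine Eq.trans ?_ (MemLp.toLp_const_smul c (memLp_toeplitz ht p f g.toLp))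
        refine MemLp.toLp_congr (memLp_toeplitz ht p f (c • g).toLp) _
          (Filter.Eventually.of_forall fun z => ?_)
        rw [map_smul, fockProj_smul ht] }
    ((projBound n t).toReal * ‖f‖)
    (fun g => norm_toeplitz_le ht p f g.toLp)

theorem coeFn_toeplitz {n : ℕ} {t : ℝ} (ht : 0 < t) (p : Exponent) (f : Cn n →ᵇ ℂ)
    (g : FockSpace n t p) :
    (toeplitz ht p f g).toLp =ᵐ[gaussianMeasure n (2 * t / p)]
      fockProj t fun w => f w * g.toLp w :=
  MemLp.coeFn_toLp (memLp_toeplitz ht p f g.toLp)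

/-- `T_lin^{p,t}(S)`: the operator norm closed linear span of the `T_f^t`, `f ∈ S`. -/
def toeplitzLin {n : ℕ} {t : ℝ} (ht : 0 < t) (p : Exponent) (S : Set (Cn n →ᵇ ℂ)) :
    Submodule ℂ (FockOp n t p) :=
  (Submodule.span ℂ (toeplitz ht p '' S)).topologicalClosure

/-- `T^{p,t}(S)`: the Banach algebra generated by the `T_f^t`, `f ∈ S`, that is, the operator norm
closure of the (not necessarily unital) algebra generated by them. -/
def toeplitzAlg {n : ℕ} {t : ℝ} (ht : 0 < t) (p : Exponent) (S : Set (Cn n →ᵇ ℂ)) :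
    NonUnitalSubalgebra ℂ (FockOp n t p) :=
  (NonUnitalAlgebra.adjoin ℂ (toeplitz ht p '' S)).topologicalClosure

/-- The bounded uniformly continuous functions on `ℂⁿ`, with the supremum norm. -/
def BUC (n : ℕ) : Set (Cn n →ᵇ ℂ) := {f | UniformContinuous f}

/-- The translate `α_z f = f(· - z)`. -/
def translate {n : ℕ} (z : Cn n) (f : Cn n →ᵇ ℂ) : Cn n →ᵇ ℂ :=
  f.compContinuous ⟨fun w => w - z, continuous_id.sub continuous_const⟩

/-- `α`-invariance of a set of functions. -/
def AlphaInvariant {n : ℕ} (S : Set (Cn n →ᵇ ℂ)) : Prop :=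
  ∀ z : Cn n, ∀ f ∈ S, translate z f ∈ S

/-- `J` is a left ideal in `A`. -/
def IsLeftIdealIn {R : Type*} [Ring R] [Algebra ℂ R] (J A : Submodule ℂ R) : Prop :=
  J ≤ A ∧ ∀ a ∈ A, ∀ b ∈ J, a * b ∈ J

/-- `J` is a right ideal in `A`. -/
def IsRightIdealIn {R : Type*} [Ring R] [Algebra ℂ R] (J A : Submodule ℂ R) : Prop :=
  J ≤ A ∧ ∀ a ∈ A, ∀ b ∈ J, b * a ∈ J

/-- `J` is a two-sided ideal in `A`. -/
def IsTwoSidedIdealIn {R : Type*} [Ring R] [Algebra ℂ R] (J A : Submodule ℂ R) : Prop :=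
  IsLeftIdealIn J A ∧ IsRightIdealIn J A

end

end Fock

/-! Everything reduces to products of two generators. `T_lin(D₀)` is closed under multiplication
exactly when all products `T_f T_g` with `f, g ∈ D₀` lie in it, and the ideal conditions reduce in
the same way. So it suffices to characterise `T_f T_g ∈ T_lin(S)`, for a fixed α-invariant `S ⊆
BUC`, by a condition that does not mention `p`. The condition is that the Berezin transform of `T_f
T_g`, the bounded continuous function `pairBerezin t f g`, lies in the closed linear span of `S` in
the sup norm (`toeplitz_mul_mem_toeplitzLin_iff`).

Necessity: the Berezin transform is bounded from the operator norm to the sup norm and sends `T_f`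
to the heat transform of `f`. That transform is a Gaussian average of translates of `f`, so it stays
in the closed span of `S` (`mem_closedSpan_of_mem_toeplitzLin`).

Sufficiency: averaging `T_{α_z f} T_{α_z g}` over `z` against `μ_t` gives the Toeplitz operator
whose symbol is the Berezin transform of `T_f T_g` (`integral_toeplitz_mul_translate`). If `T_f T_g`
were outside `T_lin(S)`, Hahn–Banach would give a functional `L` vanishing on `T_lin(S)` but not at
`T_f T_g`. The bounded continuous function `z ↦ L (T_{α_z f} T_{α_z g})` then has zero heat
transform: by the averaging identity its values are `L` of Toeplitz operators with translates of
`pairBerezin t f g` as symbols. The heat transform is injective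
(`eq_zero_of_integral_gaussianMeasure`), so the function vanishes, also at `z = 0`, a contradiction.
-/

namespace Fock

/-! ### Algebra of the Hermitian form. -/

variable {n : ℕ} {t : ℝ} {p : Exponent}

theorem sqNorm_nonneg (z : Cn n) : 0 ≤ sqNorm z := Finset.sum_nonneg fun _ _ => sq_nonneg _

@[simp] theorem sqNorm_neg (z : Cn n) : sqNorm (-z) = sqNorm z := by simp [sqNorm]

theorem herm_add_left (a b w : Cn n) : herm (a + b) w = herm a w + herm b w := by
  simp [herm, add_mul, Finset.sum_add_distrib]

theorem herm_add_right (w a b : Cn n) : herm w (a + b) = herm w a + herm w b := by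
  simp [herm, mul_add, Finset.sum_add_distrib]

theorem herm_sub_left (a b w : Cn n) : herm (a - b) w = herm a w - herm b w := by
  simp [herm, sub_mul, Finset.sum_sub_distrib]

theorem herm_sub_right (w a b : Cn n) : herm w (a - b) = herm w a - herm w b := by
  simp [herm, mul_sub, Finset.sum_sub_distrib]

theorem herm_smul_left (c : ℂ) (z w : Cn n) : herm (c • z) w = c * herm z w := by
  simp [herm, Finset.mul_sum, mul_assoc]

theorem herm_self (z : Cn n) : herm z z = sqNorm z := by
  simp [herm, sqNorm, Complex.mul_conj, Complex.normSq_eq_norm_sq]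

theorem herm_re_comm (z w : Cn n) : (herm z w).re = (herm w z).re := by
  simp only [herm, Complex.re_sum]
  refine Finset.sum_congr rfl fun i _ => ?_
  simp
  ring

theorem herm_self_re (z : Cn n) : (herm z z).re = sqNorm z := by simp [herm_self]

theorem sqNorm_add (z w : Cn n) :
    sqNorm (z + w) = sqNorm z + sqNorm w + 2 * (herm z w).re := by
  simp only [← herm_self_re, herm_add_left, herm_add_right, Complex.add_re, herm_re_comm w z]
  ring

theorem two_mul_re_herm_le (z w : Cn n) : 2 * (herm z w).re ≤ sqNorm z + sqNorm w := by
  have := sqNorm_sub z w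
  have := sqNorm_nonneg (z - w)
  linarith

theorem sqNorm_add_le (z w : Cn n) : sqNorm (z + w) ≤ 2 * sqNorm z + 2 * sqNorm w := by
  have := sqNorm_add z w
  have := two_mul_re_herm_le z w
  linarith

theorem continuous_herm : Continuous fun p : Cn n × Cn n => herm p.1 p.2 := by
  unfold herm; fun_prop

@[fun_prop]
theorem Continuous.fock_herm {X : Type*} [TopologicalSpace X] {a b : X → Cn n}
    (ha : Continuous a) (hb : Continuous b) : Continuous fun x => herm (a x) (b x) :=
  continuous_herm.comp (ha.prodMk hb)

@[fun_prop]
theorem Continuous.fock_sqNorm {X : Type*} [TopologicalSpace X] {a : X → Cn n}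
    (ha : Continuous a) : Continuous fun x => sqNorm (a x) :=
  continuous_sqNorm.comp ha

/-! ### Gaussian measures, rotation invariance and the mean value property. -/

theorem integral_gaussianMeasure {E : Type*} [NormedAddCommGroup E] [NormedSpace ℝ E]
    (ht : 0 < t) (F : Cn n → E) :
    ∫ w, F w ∂gaussianMeasure n t = ∫ w, gaussianDensity n t w • F w := by
  unfold gaussianMeasure
  rw [integral_withDensity_eq_integral_toReal_smul
    continuous_gaussianDensity.measurable.ennreal_ofReal
    (Filter.Eventually.of_forall fun _ => ENNReal.ofReal_lt_top)]
  simp only [ENNReal.toReal_ofReal (gaussianDensity_pos ht _).le]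

theorem integrable_gaussianMeasure_iff {E : Type*} [NormedAddCommGroup E] [NormedSpace ℝ E]
    (ht : 0 < t) {F : Cn n → E} :
    Integrable F (gaussianMeasure n t) ↔ Integrable fun w => gaussianDensity n t w • F w := by
  unfold gaussianMeasure
  rw [integrable_withDensity_iff_integrable_smul'
    continuous_gaussianDensity.measurable.ennreal_ofReal
    (Filter.Eventually.of_forall fun _ => ENNReal.ofReal_lt_top)]
  simp only [ENNReal.toReal_ofReal (gaussianDensity_pos ht _).le]

theorem integral_exp_sqNorm {b : ℝ} (hb : 0 < b) :
    ∫ z : Cn n, Real.exp (-b * sqNorm z) = (Real.pi / b) ^ n := by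
  have h := integral_fintype_prod_volume_eq_prod (𝕜 := ℝ) (ι := Fin n) (E := fun _ => ℂ)
    fun _ z => Real.exp (-b * ‖z‖ ^ 2)
  simp only [GaussianFourier.integral_rexp_neg_mul_sq_norm (V := ℂ) hb, ← Real.exp_sum,
    ← Finset.mul_sum] at h
  simpa [sqNorm, div_pow] using h

theorem integrable_gaussianDensity (ht : 0 < t) : Integrable (gaussianDensity n t) := by
  have := (integrable_exp_sqNorm (n := n) (b := 1 / t) (by positivity)).const_mul
    (1 / (Real.pi * t) ^ n)
  refine this.congr (Filter.Eventually.of_forall fun z => ?_)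
  simp only [gaussianDensity]
  congr 2
  ring

theorem integral_gaussianDensity (ht : 0 < t) : ∫ z, gaussianDensity n t z = 1 := by
  have h : ∀ z : Cn n, gaussianDensity n t z =
      1 / (Real.pi * t) ^ n * Real.exp (-(1 / t) * sqNorm z) := fun z => by
    simp only [gaussianDensity]
    congr 2
    ring
  simp only [h]
  rw [integral_const_mul, integral_exp_sqNorm (by positivity)]
  have := Real.pi_pos
  rw [div_div_eq_mul_div, div_one]
  exact one_div_mul_cancel (by positivity)

theorem isProbabilityMeasure_gaussianMeasure (ht : 0 < t) :
    IsProbabilityMeasure (gaussianMeasure n t) := by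
  refine ⟨?_⟩
  unfold gaussianMeasure
  rw [withDensity_apply _ MeasurableSet.univ, Measure.restrict_univ,
    ← ofReal_integral_eq_lintegral_ofReal (integrable_gaussianDensity ht)
      (Filter.Eventually.of_forall fun z => (gaussianDensity_pos ht z).le),
    integral_gaussianDensity ht, ENNReal.ofReal_one]

theorem measurePreserving_circle_smul (c : Circle) :
    MeasurePreserving (fun z : Cn n => (c : ℂ) • z) := by
  have h : MeasurePreserving (fun z : ℂ => (c : ℂ) * z) :=
    (rotation c).measurePreserving
  exact volume_preserving_pi (ι := Fin n) (α' := fun _ => ℂ) (β' := fun _ => ℂ)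
    (f := fun _ z => (c : ℂ) * z) fun _ => h

theorem sqNorm_circle_smul (c : Circle) (z : Cn n) : sqNorm ((c : ℂ) • z) = sqNorm z := by
  simp [sqNorm, Circle.norm_coe]

theorem measurableEmbedding_circle_smul (c : Circle) :
    MeasurableEmbedding (fun z : Cn n => (c : ℂ) • z) :=
  (Homeomorph.smulOfNeZero (c : ℂ) (Circle.coe_ne_zero c)).measurableEmbedding

theorem integral_circle_smul {E : Type*} [NormedAddCommGroup E] [NormedSpace ℝ E] (ht : 0 < t)
    (c : Circle) (F : Cn n → E) :
    ∫ z, F ((c : ℂ) • z) ∂gaussianMeasure n t = ∫ z, F z ∂gaussianMeasure n t := by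
  rw [integral_gaussianMeasure ht, integral_gaussianMeasure ht,
    ← (measurePreserving_circle_smul c).integral_comp (measurableEmbedding_circle_smul c)
      fun z => gaussianDensity n t z • F z]
  simp only [gaussianDensity, sqNorm_circle_smul]

theorem integrable_circle_smul {E : Type*} [NormedAddCommGroup E] [NormedSpace ℝ E] (ht : 0 < t)
    (c : Circle) {F : Cn n → E} (hF : Integrable F (gaussianMeasure n t)) :
    Integrable (fun z => F ((c : ℂ) • z)) (gaussianMeasure n t) := by
  rw [integrable_gaussianMeasure_iff ht] at hF ⊢
  have := (measurePreserving_circle_smul c).integrable_comp_of_integrable hF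
  refine this.congr (Filter.Eventually.of_forall fun z => ?_)
  simp only [Function.comp, gaussianDensity, sqNorm_circle_smul]

/-- The mean value property of entire functions with respect to Gaussian measures. -/
theorem integral_gaussianMeasure_of_differentiable (ht : 0 < t) {G : Cn n → ℂ}
    (hG : Differentiable ℂ G) (hint : Integrable G (gaussianMeasure n t)) :
    ∫ z, G z ∂gaussianMeasure n t = G 0 := by
  have := isProbabilityMeasure_gaussianMeasure (n := n) ht
  have : IsFiniteMeasure (volume.restrict (Set.uIoc 0 (2 * Real.pi))) :=
    ⟨by rw [Measure.restrict_apply_univ, Set.uIoc]; exact measure_Ioc_lt_top⟩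
  have hcont := hG.continuous
  have hc : Continuous fun p : ℝ × Cn n => (Circle.exp p.1 : ℂ) • p.2 := by fun_prop
  have hrot : ∀ θ : ℝ, Integrable (fun z => G ((Circle.exp θ : ℂ) • z)) (gaussianMeasure n t) :=
    fun θ => integrable_circle_smul ht (Circle.exp θ) hint
  have hnorm : ∀ θ : ℝ, ∫ z, ‖G ((Circle.exp θ : ℂ) • z)‖ ∂gaussianMeasure n t =
      ∫ z, ‖G z‖ ∂gaussianMeasure n t :=
    fun θ => integral_circle_smul ht (Circle.exp θ) fun z => ‖G z‖
  -- Rotations preserve the Gaussian measure, so the inner integral of the norm is independent of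
  -- `θ`; this licenses Fubini.
  have hprod : Integrable (fun p : ℝ × Cn n => G ((Circle.exp p.1 : ℂ) • p.2))
      ((volume.restrict (Set.uIoc 0 (2 * Real.pi))).prod (gaussianMeasure n t)) := by
    refine (integrable_prod_iff (hcont.comp hc).aestronglyMeasurable).2 ⟨?_, ?_⟩
    · exact Filter.Eventually.of_forall hrot
    · simp only [Function.comp, hnorm]
      exact integrable_const _
  have hswap := intervalIntegral_integral_swap
    (f := fun (θ : ℝ) (z : Cn n) => G ((Circle.exp θ : ℂ) • z)) hprod
  simp only [fun θ => integral_circle_smul ht (Circle.exp θ) G] at hswap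
  -- The one-variable mean value property on the complex line through `z`; every such circle has its
  -- centre at the origin.
  have hmean : ∀ z : Cn n, ∫ θ in (0 : ℝ)..2 * Real.pi, G ((Circle.exp θ : ℂ) • z) =
      (2 * Real.pi : ℝ) • G 0 := by
    intro z
    have hd : Differentiable ℂ fun c : ℂ => G (c • z) := by fun_prop
    have h := (hd.diffContOnCl (s := Metric.ball 0 |1|)).circleAverage
    rw [Real.circleAverage_def, inv_smul_eq_iff₀ (by positivity)] at h
    simpa [circleMap] using h
  simp only [hmean, intervalIntegral.integral_const, sub_zero, integral_const,
    probReal_univ, one_smul] at hswap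
  exact smul_right_injective ℂ (r := 2 * Real.pi) (by positivity) hswap

/-! ### The Bergman kernel and its reproducing property. -/

/-- The integral kernel of `fockProj` with respect to Lebesgue measure. -/
noncomputable def bergman (n : ℕ) (t : ℝ) (z w : Cn n) : ℂ :=
  1 / (Real.pi * t : ℂ) ^ n * Complex.exp ((herm z w - herm w w) / t)

theorem gaussianDensity_smul_exp (z w : Cn n) (c : ℂ) :
    gaussianDensity n t w • (Complex.exp (herm z w / t) * c) = bergman n t z w * c := by
  unfold gaussianDensity bergman
  rw [herm_self, sub_div, sub_eq_neg_add, Complex.exp_add, Complex.real_smul]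
  push_cast
  rw [neg_div]
  ring

theorem fockProj_eq_integral (ht : 0 < t) (F : Cn n → ℂ) (z : Cn n) :
    fockProj t F z = ∫ w, bergman n t z w * F w := by
  unfold fockProj
  rw [integral_gaussianMeasure ht]
  simp only [gaussianDensity_smul_exp]

theorem integrable_bergman_mul_iff (ht : 0 < t) {F : Cn n → ℂ} {z : Cn n} :
    Integrable (fun w => Complex.exp (herm z w / t) * F w) (gaussianMeasure n t) ↔
      Integrable fun w => bergman n t z w * F w := by
  rw [integrable_gaussianMeasure_iff ht]
  simp only [gaussianDensity_smul_exp]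

/-- The reproducing property of the Bergman kernel. -/
theorem integral_bergman_mul (ht : 0 < t) {H : Cn n → ℂ} (hH : Differentiable ℂ H) {c : Cn n}
    (hint : Integrable fun w => bergman n t c w * H w) :
    ∫ w, bergman n t c w * H w = H c := by
  have hdiff : Differentiable ℂ fun w : Cn n => herm w c := by
    unfold herm; fun_prop
  -- Recentring at `c` turns the kernel into a centred Gaussian times a factor holomorphic in `w`,
  -- so the mean value property at `0` returns `H c`.
  have key : ∀ w, bergman n t c (c + w) * H (c + w) =
      gaussianDensity n t w • (Complex.exp (-herm w c / t) * H (c + w)) := by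
    intro w
    unfold gaussianDensity bergman
    rw [Complex.real_smul]
    push_cast
    rw [← herm_self, mul_assoc, mul_assoc, ← mul_assoc (Complex.exp _) (Complex.exp _),
      ← Complex.exp_add]
    congr 3
    simp only [herm_add_left, herm_add_right]
    ring
  rw [← integral_add_left_eq_self _ c]
  simp only [key]
  rw [← integral_gaussianMeasure ht, integral_gaussianMeasure_of_differentiable ht]
  · simp [herm]
  · fun_prop
  · rw [integrable_gaussianMeasure_iff ht]
    simp only [← key]
    exact hint.comp_add_left c

theorem Exponent.pos (p : Exponent) : (0 : ℝ) < p := one_pos.trans p.2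

/-- Functions in `L^p(ℂⁿ, μ_{2t/p})`. -/
abbrev MemWeightedLp (n : ℕ) (t : ℝ) (p : Exponent) (F : Cn n → ℂ) : Prop :=
  MemLp F (ENNReal.ofReal (p : ℝ)) (gaussianMeasure n (2 * t / p))

/-- The entire functions in `L^p(ℂⁿ, μ_{2t/p})` are fixed by the projection. -/
theorem fockProj_eq_self (ht : 0 < t) {F : Cn n → ℂ} (hF : Differentiable ℂ F)
    (hp : MemWeightedLp n t p F) : fockProj t F = F := by
  funext z
  rw [fockProj_eq_integral ht]
  exact integral_bergman_mul ht hF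
    ((integrable_bergman_mul_iff ht).1 (integrable_kernel ht p.one_lt hp z))

theorem fockProj_congr (ht : 0 < t) {F G : Cn n → ℂ}
    (h : F =ᵐ[gaussianMeasure n (2 * t / p)] G) : fockProj t F = fockProj t G := by
  funext z
  refine integral_congr_ae ?_
  filter_upwards [ae_of_ae_weight ht h] with w hw
  rw [hw]

/-! ### Point evaluations and reproducing kernels in the Fock space. -/

/-- After weighting, the projection is dominated by convolution with a Gaussian, which lies in `L^q`
for the conjugate exponent `q`. Hölder gives the bound, and translation invariance of Lebesgue
measure makes the constant independent of `z`. -/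
theorem exists_norm_fockProj_le (ht : 0 < t) (p : Exponent) :
    ∃ C : ℝ, 0 ≤ C ∧ ∀ F : Cn n → ℂ, MemWeightedLp n t p F → ∀ z,
      ‖fockProj t F z‖ ≤ C * Real.exp (sqNorm z / (2 * t)) *
        (eLpNorm F (ENNReal.ofReal (p : ℝ)) (gaussianMeasure n (2 * t / p))).toReal := by
  have hp := p.one_lt
  have hp0 := p.pos
  have hpi := Real.pi_pos
  have hpq := Real.HolderConjugate.conjExponent hp
  set q := (p : ℝ).conjExponent with hq
  have hq0 : 0 < q := hpq.symm.pos
  set c := ENNReal.ofReal (1 / (Real.pi * t) ^ n)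
  set c' := ENNReal.ofReal (1 / (Real.pi * (2 * t / p)) ^ n) with hc'
  have hc0 : c' ≠ 0 := by rw [hc']; simp only [ne_eq, ENNReal.ofReal_eq_zero, not_le]; positivity
  have hct : c' ≠ ∞ := ENNReal.ofReal_ne_top
  have hc1 : c' ^ (1 / (p : ℝ)) ≠ 0 := by
    simp [ENNReal.rpow_eq_zero_iff, hc0, hct]
  set K := ∫⁻ w : Cn n, ENNReal.ofReal (Real.exp (-(1 / (2 * t)) * sqNorm w)) ^ q with hK
  have hKt : K ≠ ∞ := by
    have : ∀ w : Cn n, ENNReal.ofReal (Real.exp (-(1 / (2 * t)) * sqNorm w)) ^ q =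
        ENNReal.ofReal (Real.exp (-(q / (2 * t)) * sqNorm w)) := fun w => by
      rw [ENNReal.ofReal_rpow_of_nonneg (by positivity) hq0.le, ← Real.exp_mul]
      congr 2
      ring
    simp only [hK, this]
    exact (integrable_exp_sqNorm (by positivity)).lintegral_lt_top.ne
  set B := c * (K ^ (1 / q) * (c' ^ (1 / (p : ℝ)))⁻¹) with hB
  have hBt : B ≠ ∞ := by
    refine ENNReal.mul_ne_top ENNReal.ofReal_ne_top (ENNReal.mul_ne_top ?_ ?_)
    · exact (ENNReal.rpow_lt_top_of_nonneg (by positivity) hKt).ne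
    · exact ENNReal.inv_ne_top.2 hc1
  refine ⟨B.toReal, ENNReal.toReal_nonneg, fun F hF z => ?_⟩
  have hm : Measurable fun w : Cn n => ENNReal.ofReal (Real.exp (-(1 / (2 * t)) * sqNorm w)) :=
    (by fun_prop : Continuous fun w : Cn n =>
      Real.exp (-(1 / (2 * t)) * sqNorm w)).measurable.ennreal_ofReal
  have h1 : weighted t (fockProj t F) z ≤ B *
      eLpNorm F (ENNReal.ofReal (p : ℝ)) (gaussianMeasure n (2 * t / p)) := by
    refine (enorm_fockProj_le ht F z).trans ?_
    rw [hB, mul_assoc]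
    refine mul_le_mul' le_rfl ?_
    refine (ENNReal.lintegral_mul_le_Lp_mul_Lq volume hpq.symm
      (f := fun w => ENNReal.ofReal (Real.exp (-(1 / (2 * t)) * sqNorm (z - w))))
      (g := weighted t F) (hm.comp (measurable_const.sub measurable_id)).aemeasurable
      (weighted_aemeasurable (aesm_volume ht hp hF))).trans (le_of_eq ?_)
    rw [lintegral_sub_left_eq_self
      (fun w => ENNReal.ofReal (Real.exp (-(1 / (2 * t)) * sqNorm w)) ^ q) z, ← hK, mul_assoc]
    congr 1
    rw [eLpNorm_eq ht hp, ENNReal.mul_rpow_of_nonneg _ _ (by positivity), ← mul_assoc,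
      ENNReal.inv_mul_cancel hc1 (ENNReal.rpow_lt_top_of_nonneg (by positivity) hct).ne, one_mul]
  have h2 := ENNReal.toReal_mono (ENNReal.mul_ne_top hBt hF.2.ne) h1
  unfold weighted at h2
  rw [ENNReal.toReal_mul, ENNReal.toReal_mul, toReal_enorm, ENNReal.toReal_ofReal
    (Real.exp_pos _).le] at h2
  calc ‖fockProj t F z‖ = ‖fockProj t F z‖ * Real.exp (-(sqNorm z) / (2 * t)) *
        Real.exp (sqNorm z / (2 * t)) := by
        rw [mul_assoc, ← Real.exp_add, neg_div, neg_add_cancel, Real.exp_zero, mul_one]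
    _ ≤ _ := by
        rw [mul_right_comm B.toReal]
        exact mul_le_mul_of_nonneg_right h2 (Real.exp_pos _).le

/-- A constant for which the point evaluations satisfy `|h z| ≤ C exp (|z|² / (2t)) ‖h‖`. -/
noncomputable def evalConst (n : ℕ) (ht : 0 < t) (p : Exponent) : ℝ :=
  (exists_norm_fockProj_le (n := n) ht p).choose

theorem evalConst_nonneg (ht : 0 < t) : 0 ≤ evalConst n ht p :=
  (exists_norm_fockProj_le (n := n) ht p).choose_spec.1

/-- Point evaluation on `F_t^p`. -/
noncomputable def eval (ht : 0 < t) (z : Cn n) : FockSpace n t p →L[ℂ] ℂ :=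
  LinearMap.mkContinuous
    { toFun := fun h => fockProj t h.toLp z
      map_add' := fun g h => by
        have := congrFun (fockProj_add ht 1 g.toLp h.toLp) z
        simpa using this
      map_smul' := fun c h => by
        have := congrFun (fockProj_smul ht 1 c h.toLp) z
        simpa using this }
    (evalConst n ht p * Real.exp (sqNorm z / (2 * t)))
    (fun h => by
      have := (exists_norm_fockProj_le (n := n) ht p).choose_spec.2 h.toLp (Lp.memLp _) z
      rw [← Lp.norm_def, LinearIsometry.norm_map] at this
      exact this)

theorem eval_apply (ht : 0 < t) (z : Cn n) (h : FockSpace n t p) :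
    eval ht z h = fockProj t h.toLp z := rfl

theorem norm_eval_apply_le (ht : 0 < t) (z : Cn n) (h : FockSpace n t p) :
    ‖eval ht z h‖ ≤ evalConst n ht p * Real.exp (sqNorm z / (2 * t)) * ‖h‖ := by
  have := (exists_norm_fockProj_le (n := n) ht p).choose_spec.2 h.toLp (Lp.memLp _) z
  rw [← Lp.norm_def, LinearIsometry.norm_map] at this
  exact this

/-- Evaluation through `P_t` makes sense on almost-everywhere classes; the reproducing property
identifies it with the value of the entire representative. -/
theorem eval_eq_of_ae (ht : 0 < t) {h : FockSpace n t p} {F : Cn n → ℂ}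
    (hF : Differentiable ℂ F) (hae : h.toLp =ᵐ[gaussianMeasure n (2 * t / p)] F) (z : Cn n) :
    eval ht z h = F z := by
  rw [eval_apply, fockProj_congr ht hae,
    fockProj_eq_self ht hF ((memLp_congr_ae hae).1 (Lp.memLp _))]

theorem exists_differentiable_ae (h : FockSpace n t p) :
    ∃ F : Cn n → ℂ, Differentiable ℂ F ∧ h.toLp =ᵐ[gaussianMeasure n (2 * t / p)] F := h.2

theorem differentiable_eval (ht : 0 < t) (h : FockSpace n t p) :
    Differentiable ℂ fun z => eval ht z h :=
  differentiable_fockProj ht p.one_lt (Lp.memLp h.toLp)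

theorem toLp_ae_eq_eval (ht : 0 < t) (h : FockSpace n t p) :
    h.toLp =ᵐ[gaussianMeasure n (2 * t / p)] fun z => eval ht z h := by
  obtain ⟨F, hF, hae⟩ := exists_differentiable_ae h
  rw [show (fun z => eval ht z h) = F from funext fun z => eval_eq_of_ae ht hF hae z]
  exact hae

theorem ext_eval (ht : 0 < t) {g h : FockSpace n t p} (H : ∀ z, eval ht z g = eval ht z h) :
    g = h := by
  refine FockSpace.toLp.injective (Lp.ext ?_)
  refine (toLp_ae_eq_eval ht g).trans ?_
  simp only [H]
  exact (toLp_ae_eq_eval ht h).symm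

theorem eval_toeplitz (ht : 0 < t) (f : Cn n →ᵇ ℂ) (g : FockSpace n t p) (z : Cn n) :
    eval ht z (toeplitz ht p f g) = ∫ w, bergman n t z w * (f w * eval ht w g) := by
  rw [eval_eq_of_ae ht (differentiable_fockProj ht p.one_lt (memLp_symbol_mul f g.toLp))
    (coeFn_toeplitz ht p f g), ← fockProj_eq_integral ht]
  refine congrFun (fockProj_congr (p := p) ht ?_) z
  filter_upwards [toLp_ae_eq_eval ht g] with w hw
  rw [hw]

/-- The element of `F_t^p` given by an entire function. -/
noncomputable def ofFun (F : Cn n → ℂ) (hF : Differentiable ℂ F) (hp : MemWeightedLp n t p F) :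
    FockSpace n t p :=
  ⟨hp.toLp F, F, hF, MemLp.coeFn_toLp _⟩

theorem coeFn_ofFun {F : Cn n → ℂ} (hF : Differentiable ℂ F) (hp : MemWeightedLp n t p F) :
    (ofFun F hF hp).toLp =ᵐ[gaussianMeasure n (2 * t / p)] F :=
  MemLp.coeFn_toLp (p := ENNReal.ofReal (p : ℝ)) hp

theorem eval_ofFun (ht : 0 < t) {F : Cn n → ℂ} (hF : Differentiable ℂ F)
    (hp : MemWeightedLp n t p F) (z : Cn n) : eval ht z (ofFun F hF hp) = F z :=
  eval_eq_of_ae ht hF (coeFn_ofFun hF hp) z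

theorem norm_ofFun {F : Cn n → ℂ} (hF : Differentiable ℂ F) (hp : MemWeightedLp n t p F) :
    ‖ofFun F hF hp‖ =
      (eLpNorm F (ENNReal.ofReal (p : ℝ)) (gaussianMeasure n (2 * t / p))).toReal :=
  Lp.norm_toLp F hp

/-- Completing the square turns the weighted kernel into a Gaussian centred at `z`. The scaling
`2t/p` of the measure makes the norm the same for every `p`, and it matches the growth of point
evaluations, which is what bounds the Berezin transform. -/
theorem eLpNorm_exp_herm (ht : 0 < t) (p : Exponent) (z : Cn n) :
    eLpNorm (fun w => Complex.exp (herm w z / t)) (ENNReal.ofReal (p : ℝ))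
      (gaussianMeasure n (2 * t / p)) = ENNReal.ofReal (Real.exp (sqNorm z / (2 * t))) := by
  have hp := p.one_lt
  have hp0 := p.pos
  have hpi := Real.pi_pos
  have h1 : ∀ w, weighted t (fun w => Complex.exp (herm w z / t)) w ^ (p : ℝ) =
      ENNReal.ofReal (Real.exp (p * (sqNorm z / (2 * t)))) *
        ENNReal.ofReal (Real.exp (-(p / (2 * t)) * sqNorm (w - z))) := by
    intro w
    unfold weighted
    rw [← ofReal_norm, Complex.norm_exp, Complex.div_ofReal_re,
      ← ENNReal.ofReal_mul (by positivity), ← Real.exp_add,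
      ENNReal.ofReal_rpow_of_nonneg (by positivity) hp0.le, ← Real.exp_mul,
      ← ENNReal.ofReal_mul (by positivity), ← Real.exp_add, sqNorm_sub]
    congr 2
    field_simp
    ring
  rw [eLpNorm_eq ht hp]
  simp only [h1]
  rw [lintegral_const_mul' _ _ ENNReal.ofReal_ne_top,
    lintegral_sub_right_eq_self
      (fun w => ENNReal.ofReal (Real.exp (-(p / (2 * t)) * sqNorm w))) z,
    ← ofReal_integral_eq_lintegral_ofReal (integrable_exp_sqNorm (by positivity))
      (Filter.Eventually.of_forall fun w => (Real.exp_pos _).le),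
    integral_exp_sqNorm (by positivity), ← ENNReal.ofReal_mul (by positivity),
    ← ENNReal.ofReal_mul (by positivity),
    ENNReal.ofReal_rpow_of_nonneg (by positivity) (by positivity)]
  congr 1
  have h2 : 1 / (Real.pi * (2 * t / p)) ^ n *
      (Real.exp (p * (sqNorm z / (2 * t))) * (Real.pi / (p / (2 * t))) ^ n) =
      Real.exp (p * (sqNorm z / (2 * t))) := by
    rw [show Real.pi / (p / (2 * t)) = Real.pi * (2 * t / p) by field_simp]
    field_simp
  rw [h2, ← Real.exp_mul]
  congr 1
  field_simp

theorem differentiable_exp_herm (z : Cn n) :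
    Differentiable ℂ fun w : Cn n => Complex.exp (herm w z / t) := by
  unfold herm; fun_prop

theorem memWeightedLp_exp_herm (ht : 0 < t) (p : Exponent) (z : Cn n) :
    MemWeightedLp n t p fun w => Complex.exp (herm w z / t) :=
  ⟨(differentiable_exp_herm z).continuous.aestronglyMeasurable, by
    rw [eLpNorm_exp_herm ht]; exact ENNReal.ofReal_lt_top⟩

/-- The reproducing kernel `w ↦ exp (w ⬝ conj z / t)` as an element of `F_t^p`. -/
noncomputable def expKernel (ht : 0 < t) (p : Exponent) (z : Cn n) : FockSpace n t p :=
  ofFun _ (differentiable_exp_herm z) (memWeightedLp_exp_herm ht p z)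

theorem eval_expKernel (ht : 0 < t) (z w : Cn n) :
    eval ht w (expKernel ht p z) = Complex.exp (herm w z / t) := eval_ofFun ht _ _ w

theorem norm_expKernel (ht : 0 < t) (z : Cn n) :
    ‖expKernel ht p z‖ = Real.exp (sqNorm z / (2 * t)) := by
  rw [expKernel, norm_ofFun, eLpNorm_exp_herm ht, ENNReal.toReal_ofReal (Real.exp_pos _).le]

/-! ### The projection, and completeness of the Fock space. -/

/-- The projection `P_t` as a bounded operator on `L^p(ℂⁿ, μ_{2t/p})`. -/
noncomputable def projL (n : ℕ) (ht : 0 < t) (p : Exponent) :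
    WeightedLp n t p →L[ℂ] WeightedLp n t p :=
  LinearMap.mkContinuous
    { toFun := fun g => (memLp_toeplitz ht p 1 g).toLp _
      map_add' := fun g h => by
        rw [← MemLp.toLp_add]
        exact MemLp.toLp_congr _ _ (Filter.Eventually.of_forall fun z => by rw [fockProj_add ht])
      map_smul' := fun c g => by
        refine Eq.trans ?_ (MemLp.toLp_const_smul c (memLp_toeplitz ht p 1 g))
        exact MemLp.toLp_congr _ _ (Filter.Eventually.of_forall fun z => by rw [fockProj_smul ht]) }
    ((projBound n t).toReal * ‖(1 : Cn n →ᵇ ℂ)‖)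
    (fun g => norm_toeplitz_le ht p 1 g)

theorem coeFn_projL (ht : 0 < t) (g : WeightedLp n t p) :
    projL n ht p g =ᵐ[gaussianMeasure n (2 * t / p)] fockProj t g := by
  refine (MemLp.coeFn_toLp (memLp_toeplitz ht p 1 g)).trans ?_
  simp

theorem mem_fockSubmodule_iff (ht : 0 < t) {g : WeightedLp n t p} :
    g ∈ fockSubmodule n t p ↔ projL n ht p g = g := by
  constructor
  · rintro ⟨F, hF, hae⟩
    refine Lp.ext ((coeFn_projL ht g).trans ?_)
    rw [fockProj_congr ht hae, fockProj_eq_self ht hF ((memLp_congr_ae hae).1 (Lp.memLp _))]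
    exact hae.symm
  · intro h
    refine ⟨fockProj t g, differentiable_fockProj ht p.one_lt (Lp.memLp g), ?_⟩
    nth_rewrite 1 [← h]
    exact coeFn_projL ht g

/-- The Fock space is the fixed-point set of a bounded operator on `L^p`, hence closed. Completeness
is needed to move continuous functionals through operator-valued Bochner integrals. -/
theorem completeSpace_fockSpace (ht : 0 < t) : CompleteSpace (FockSpace n t p) := by
  have h : IsClosed (fockSubmodule n t p : Set (WeightedLp n t p)) := by
    have : (fockSubmodule n t p : Set (WeightedLp n t p)) = {g | projL n ht p g = g} :=
      Set.ext fun g => mem_fockSubmodule_iff ht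
    rw [this]
    exact isClosed_eq (projL n ht p).continuous continuous_id
  exact h.completeSpace_coe

/-! ### Dependence on the symbol, translations and closed spans. -/

theorem norm_toeplitz_le_mul (ht : 0 < t) (f : Cn n →ᵇ ℂ) :
    ‖toeplitz ht p f‖ ≤ (projBound n t).toReal * ‖f‖ :=
  LinearMap.mkContinuous_norm_le _ (by positivity) _

theorem integrable_bergman_mul_eval (ht : 0 < t) (f : Cn n →ᵇ ℂ) (g : FockSpace n t p)
    (z : Cn n) : Integrable fun w => bergman n t z w * (f w * eval ht w g) := by
  refine (integrable_bergman_mul_iff ht).1 (integrable_kernel ht p.one_lt ?_ z)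
  refine (memLp_congr_ae ?_).1 (memLp_symbol_mul f g.toLp)
  filter_upwards [toLp_ae_eq_eval ht g] with w hw
  rw [hw]

/-- The Toeplitz operator depends linearly and continuously on its symbol. -/
noncomputable def toeplitzL (n : ℕ) (ht : 0 < t) (p : Exponent) : (Cn n →ᵇ ℂ) →L[ℂ] FockOp n t p :=
  LinearMap.mkContinuous
    { toFun := toeplitz ht p
      map_add' := fun f g => by
        refine ContinuousLinearMap.ext fun h => ext_eval ht fun z => ?_
        rw [add_apply, map_add, eval_toeplitz, eval_toeplitz, eval_toeplitz,
          ← integral_add (integrable_bergman_mul_eval ht f h z)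
            (integrable_bergman_mul_eval ht g h z)]
        congr 1
        funext w
        rw [BoundedContinuousFunction.add_apply]
        ring
      map_smul' := fun c f => by
        refine ContinuousLinearMap.ext fun h => ext_eval ht fun z => ?_
        rw [RingHom.id_apply, smul_apply, map_smul, eval_toeplitz,
          eval_toeplitz, smul_eq_mul, ← integral_const_mul]
        congr 1
        funext w
        rw [BoundedContinuousFunction.smul_apply, smul_eq_mul]
        ring }
    (projBound n t).toReal
    (fun f => norm_toeplitz_le_mul ht f)

@[simp]
theorem translate_apply (z : Cn n) (f : Cn n →ᵇ ℂ) (w : Cn n) : translate z f w = f (w - z) := rfl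

theorem translate_translate (x z : Cn n) (f : Cn n →ᵇ ℂ) :
    translate x (translate z f) = translate (x + z) f := by
  ext w
  simp [sub_sub]

theorem norm_translate_le (z : Cn n) (f : Cn n →ᵇ ℂ) : ‖translate z f‖ ≤ ‖f‖ :=
  (BoundedContinuousFunction.norm_le (norm_nonneg f)).2 fun w => f.norm_coe_le_norm (w - z)

/-- This is where uniform continuity enters: it makes orbits norm continuous, so averages over
translates exist as Bochner integrals. -/
theorem continuous_translate {f : Cn n →ᵇ ℂ} (hf : f ∈ BUC n) :
    Continuous fun z => translate z f := by
  rw [Metric.continuous_iff]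
  intro z ε hε
  obtain ⟨δ, hδ, h⟩ := Metric.uniformContinuous_iff.1 hf (ε / 2) (by positivity)
  refine ⟨δ, hδ, fun a ha => lt_of_le_of_lt ?_ (half_lt_self hε)⟩
  refine (BoundedContinuousFunction.dist_le (by positivity)).2 fun w => (h ?_).le
  change dist (w - a) (w - z) < δ
  rwa [dist_sub_left]

theorem translate_mem_BUC (z : Cn n) {f : Cn n →ᵇ ℂ} (hf : f ∈ BUC n) : translate z f ∈ BUC n :=
  (hf : UniformContinuous f).comp (uniformContinuous_id.sub uniformContinuous_const)

/-- Translation as a bounded operator. -/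
noncomputable def translateL (z : Cn n) : (Cn n →ᵇ ℂ) →L[ℂ] (Cn n →ᵇ ℂ) :=
  LinearMap.mkContinuous
    { toFun := translate z
      map_add' := fun _ _ => rfl
      map_smul' := fun _ _ => rfl }
    1 fun f => by rw [one_mul]; exact norm_translate_le z f

/-- The closed linear span of a set of symbols. -/
noncomputable def closedSpan (S : Set (Cn n →ᵇ ℂ)) : Submodule ℂ (Cn n →ᵇ ℂ) :=
  (Submodule.span ℂ S).topologicalClosure

theorem isClosed_closedSpan (S : Set (Cn n →ᵇ ℂ)) : IsClosed (closedSpan S : Set (Cn n →ᵇ ℂ)) :=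
  Submodule.isClosed_topologicalClosure _

theorem subset_closedSpan (S : Set (Cn n →ᵇ ℂ)) : S ⊆ closedSpan S :=
  Submodule.subset_span.trans (Submodule.le_topologicalClosure _)

theorem map_mem_of_mem_topologicalClosure_span {E F : Type*} [NormedAddCommGroup E]
    [NormedSpace ℂ E] [NormedAddCommGroup F] [NormedSpace ℂ F] (L : E →L[ℂ] F) {S : Set E}
    {W : Submodule ℂ F} (hW : IsClosed (W : Set F)) (h : ∀ x ∈ S, L x ∈ W) {x : E}
    (hx : x ∈ (Submodule.span ℂ S).topologicalClosure) : L x ∈ W := by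
  have h1 : (Submodule.span ℂ S).topologicalClosure ≤ W.comap (L : E →ₗ[ℂ] F) :=
    Submodule.topologicalClosure_minimal _ (Submodule.span_le.2 h) (hW.preimage L.continuous)
  exact h1 hx

theorem translate_mem_closedSpan {S : Set (Cn n →ᵇ ℂ)} (hS : AlphaInvariant S) (z : Cn n)
    {f : Cn n →ᵇ ℂ} (hf : f ∈ closedSpan S) : translate z f ∈ closedSpan S :=
  map_mem_of_mem_topologicalClosure_span (translateL z) (isClosed_closedSpan S)
    (fun g hg => subset_closedSpan S (hS z g hg)) hf

theorem toeplitz_mem_toeplitzLin (ht : 0 < t) {S : Set (Cn n →ᵇ ℂ)} {f : Cn n →ᵇ ℂ}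
    (hf : f ∈ closedSpan S) : toeplitz ht p f ∈ toeplitzLin ht p S :=
  map_mem_of_mem_topologicalClosure_span (toeplitzL n ht p)
    (Submodule.isClosed_topologicalClosure _)
    (fun _ hg => Submodule.le_topologicalClosure _
      (Submodule.subset_span (Set.mem_image_of_mem _ hg))) hf

/-! ### The heat transform. -/

/-- The heat transform of a symbol. -/
noncomputable def heat (t : ℝ) (f : Cn n →ᵇ ℂ) : Cn n →ᵇ ℂ :=
  ∫ u, translate (-u) f ∂gaussianMeasure n t

theorem integrable_translate (ht : 0 < t) {f : Cn n →ᵇ ℂ} (hf : f ∈ BUC n) :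
    Integrable (fun u => translate (-u) f) (gaussianMeasure n t) := by
  have := isProbabilityMeasure_gaussianMeasure (n := n) ht
  exact Integrable.of_bound
    ((continuous_translate hf).comp continuous_neg).aestronglyMeasurable ‖f‖
    (Filter.Eventually.of_forall fun u => norm_translate_le _ f)

theorem heat_apply (ht : 0 < t) {f : Cn n →ᵇ ℂ} (hf : f ∈ BUC n) (z : Cn n) :
    heat t f z = ∫ u, f (z + u) ∂gaussianMeasure n t := by
  have := (BoundedContinuousFunction.evalCLM ℂ z).integral_comp_comm (integrable_translate ht hf)
  simpa [heat] using this.symm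

/-- An average, with respect to a probability measure, of elements of a closed convex set stays in
that set; the elements here are translates of `f`. -/
theorem heat_mem_closedSpan (ht : 0 < t) {S : Set (Cn n →ᵇ ℂ)} (hsub : S ⊆ BUC n)
    (hS : AlphaInvariant S) {f : Cn n →ᵇ ℂ} (hf : f ∈ S) : heat t f ∈ closedSpan S := by
  have := isProbabilityMeasure_gaussianMeasure (n := n) ht
  exact Convex.integral_mem ((closedSpan S).restrictScalars ℝ).convex (isClosed_closedSpan S)
    (Filter.Eventually.of_forall fun u => subset_closedSpan S (hS _ f hf))
    (integrable_translate ht (hsub hf))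

/-! ### Berezin transforms of operators and of products of Toeplitz operators. -/

/-- The form of the exponent separates the weights at `z` and `w` from the Gaussian decay away from
the diagonal. -/
theorem norm_bergman (ht : 0 < t) (z w : Cn n) :
    ‖bergman n t z w‖ =
      1 / (Real.pi * t) ^ n * Real.exp ((sqNorm z - sqNorm w - sqNorm (z - w)) / (2 * t)) := by
  have hpi := Real.pi_pos
  unfold bergman
  rw [norm_mul, Complex.norm_exp, Complex.div_ofReal_re, Complex.sub_re, herm_self_re, sqNorm_sub]
  congr 1
  · rw [norm_div, norm_pow, norm_mul, Complex.norm_real, Complex.norm_real,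
      Real.norm_of_nonneg hpi.le, Real.norm_of_nonneg ht.le, norm_one]
  · congr 1
    field_simp
    ring

@[fun_prop]
theorem Continuous.fock_bergman {X : Type*} [TopologicalSpace X] {a b : X → Cn n}
    (ha : Continuous a) (hb : Continuous b) : Continuous fun x => bergman n t (a x) (b x) := by
  unfold bergman
  fun_prop

theorem integrable_exp_prod {b : ℝ} (hb : 0 < b) : Integrable fun q : Cn n × Cn n =>
    Real.exp (-b * sqNorm q.1) * Real.exp (-b * sqNorm q.2) :=
  (integrable_exp_sqNorm hb).mul_prod (integrable_exp_sqNorm hb)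

/-- The integral kernel of the Berezin transform of a product of Toeplitz operators. -/
noncomputable def pairKernel (n : ℕ) (t : ℝ) (q : Cn n × Cn n) : ℂ :=
  bergman n t 0 q.1 * bergman n t q.1 q.2

@[fun_prop]
theorem continuous_pairKernel : Continuous (pairKernel n t) := by
  unfold pairKernel; fun_prop

theorem norm_pairKernel_le (ht : 0 < t) (q : Cn n × Cn n) :
    ‖pairKernel n t q‖ ≤ (1 / (Real.pi * t) ^ n) ^ 2 *
      (Real.exp (-(1 / (2 * t)) * sqNorm q.1) * Real.exp (-(1 / (2 * t)) * sqNorm q.2)) := by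
  have hpi := Real.pi_pos
  unfold pairKernel
  have h0 : sqNorm (0 : Cn n) = 0 := by simp [sqNorm]
  have h1 := sqNorm_nonneg (q.1 - q.2)
  have h2 := sqNorm_nonneg q.1
  rw [norm_mul, norm_bergman ht, norm_bergman ht, mul_mul_mul_comm, ← sq]
  simp only [← Real.exp_add]
  refine mul_le_mul_of_nonneg_left (Real.exp_le_exp.2 ?_) (by positivity)
  rw [h0, zero_sub, zero_sub, sqNorm_neg, ← add_div, ← mul_add, neg_mul, one_div,
    inv_mul_eq_div, ← neg_div]
  gcongr
  linarith

theorem integrable_pairKernel (ht : 0 < t) : Integrable (pairKernel n t) :=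
  ((integrable_exp_prod (by positivity)).const_mul _).mono'
    continuous_pairKernel.aestronglyMeasurable
    (Filter.Eventually.of_forall fun q => norm_pairKernel_le ht q)

/-- The Berezin transform of `T_f T_g` as a bounded continuous function. -/
noncomputable def pairBerezin (t : ℝ) (f g : Cn n →ᵇ ℂ) : Cn n →ᵇ ℂ :=
  ∫ q : Cn n × Cn n, pairKernel n t q • (translate (-q.1) f * translate (-q.2) g)

theorem integrable_pairBerezin (ht : 0 < t) {f g : Cn n →ᵇ ℂ} (hf : f ∈ BUC n) (hg : g ∈ BUC n) :
    Integrable fun q : Cn n × Cn n =>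
      pairKernel n t q • (translate (-q.1) f * translate (-q.2) g) := by
  refine ((integrable_pairKernel ht).norm.mul_const (‖f‖ * ‖g‖)).mono'
    (Continuous.aestronglyMeasurable ?_) (Filter.Eventually.of_forall fun q => ?_)
  · exact continuous_pairKernel.smul
      (((continuous_translate hf).comp continuous_fst.neg).mul
        ((continuous_translate hg).comp continuous_snd.neg))
  · rw [norm_smul]
    gcongr
    exact (norm_mul_le _ _).trans
      (mul_le_mul (norm_translate_le _ _) (norm_translate_le _ _) (norm_nonneg _) (norm_nonneg _))

theorem pairBerezin_apply (ht : 0 < t) {f g : Cn n →ᵇ ℂ} (hf : f ∈ BUC n) (hg : g ∈ BUC n)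
    (z : Cn n) : pairBerezin t f g z =
      ∫ q : Cn n × Cn n, pairKernel n t q * (f (z + q.1) * g (z + q.2)) := by
  have := (BoundedContinuousFunction.evalCLM ℂ z).integral_comp_comm
    (integrable_pairBerezin ht hf hg)
  simpa [pairBerezin] using this.symm

/-- Covariance lets α-invariance of the closed span apply to the Berezin transform of every
translated product. -/
theorem translate_pairBerezin (ht : 0 < t) {f g : Cn n →ᵇ ℂ} (hf : f ∈ BUC n) (hg : g ∈ BUC n)
    (x : Cn n) : translate x (pairBerezin t f g) = pairBerezin t (translate x f) (translate x g) := by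
  ext z
  rw [translate_apply, pairBerezin_apply ht hf hg,
    pairBerezin_apply ht (translate_mem_BUC x hf) (translate_mem_BUC x hg)]
  simp only [translate_apply, add_sub_right_comm]

/-- The Berezin transform of an operator on `F_t^p`. -/
noncomputable def berezin (ht : 0 < t) (A : FockOp n t p) (z : Cn n) : ℂ :=
  Complex.exp (-herm z z / t) * eval ht z (A (expKernel ht p z))

/-- Evaluation at `z` and the kernel at `z` each contribute `exp (|z|² / (2t))`, which the
normalising factor `exp (-|z|² / t)` cancels exactly. -/
theorem norm_berezin_le (ht : 0 < t) (A : FockOp n t p) (z : Cn n) :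
    ‖berezin ht A z‖ ≤ evalConst n ht p * ‖A‖ := by
  have h1 := norm_eval_apply_le ht z (A (expKernel ht p z))
  have h2 := A.le_opNorm (expKernel ht p z)
  rw [norm_expKernel] at h2
  have h3 := evalConst_nonneg (n := n) (p := p) ht
  unfold berezin
  rw [norm_mul, Complex.norm_exp, Complex.div_ofReal_re, Complex.neg_re, herm_self_re]
  calc _ ≤ Real.exp (-sqNorm z / t) * (evalConst n ht p * Real.exp (sqNorm z / (2 * t)) *
        (‖A‖ * Real.exp (sqNorm z / (2 * t)))) := by gcongr; exact h1.trans (by gcongr)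
    _ = evalConst n ht p * ‖A‖ * (Real.exp (-sqNorm z / t) * Real.exp (sqNorm z / (2 * t)) *
        Real.exp (sqNorm z / (2 * t))) := by ring
    _ = _ := by
        rw [← Real.exp_add, ← Real.exp_add]
        have : -sqNorm z / t + sqNorm z / (2 * t) + sqNorm z / (2 * t) = 0 := by
          field_simp; ring
        rw [this, Real.exp_zero, mul_one]

theorem berezin_sub (ht : 0 < t) (A B : FockOp n t p) (z : Cn n) :
    berezin ht (A - B) z = berezin ht A z - berezin ht B z := by
  simp [berezin, mul_sub]

theorem berezin_toeplitz (ht : 0 < t) {f : Cn n →ᵇ ℂ} (hf : f ∈ BUC n) (z : Cn n) :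
    berezin ht (toeplitz ht p f) z = heat t f z := by
  unfold berezin
  rw [heat_apply ht hf, integral_gaussianMeasure ht, eval_toeplitz,
    ← integral_add_left_eq_self _ z, ← integral_const_mul]
  congr 1
  funext u
  rw [eval_expKernel]
  have h : Complex.exp (-herm z z / t) * Complex.exp ((herm z (z + u) - herm (z + u) (z + u)) / t)
      * Complex.exp (herm (z + u) z / t) = Complex.exp (-herm u u / t) := by
    rw [← Complex.exp_add, ← Complex.exp_add]
    congr 1
    simp only [herm_add_left, herm_add_right]
    ring
  unfold bergman gaussianDensity
  rw [Complex.real_smul]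
  push_cast
  rw [← herm_self]
  linear_combination (1 / (Real.pi * t : ℂ) ^ n * f (z + u)) * h

/-- After recentring at `z`, the kernel of the Berezin transform of a product no longer depends on
`z`. Hence the transform is an average of translates of the two symbols, with no trace of `p`. -/
theorem bergman_covariance (z u v : Cn n) :
    Complex.exp (-herm z z / t) * (bergman n t z (z + u) * bergman n t (z + u) (z + v)) *
      Complex.exp (herm (z + v) z / t) = pairKernel n t (u, v) := by
  have h : Complex.exp (-herm z z / t) *
      Complex.exp ((herm z (z + u) - herm (z + u) (z + u)) / t) *
      Complex.exp ((herm (z + u) (z + v) - herm (z + v) (z + v)) / t) *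
      Complex.exp (herm (z + v) z / t) = Complex.exp ((herm 0 u - herm u u) / t) *
      Complex.exp ((herm u v - herm v v) / t) := by
    simp only [← Complex.exp_add]
    congr 1
    have : herm 0 u = 0 := by simp [herm]
    simp only [herm_add_left, herm_add_right, this]
    ring
  unfold pairKernel bergman
  linear_combination (1 / (Real.pi * t : ℂ) ^ n) ^ 2 * h

theorem berezin_toeplitz_mul (ht : 0 < t) {f g : Cn n →ᵇ ℂ} (hf : f ∈ BUC n) (hg : g ∈ BUC n)
    (z : Cn n) :
    berezin ht (toeplitz ht p f * toeplitz ht p g) z = pairBerezin t f g z := by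
  have hint := (BoundedContinuousFunction.evalCLM ℂ z).integrable_comp
    (integrable_pairBerezin ht hf hg)
  simp only [BoundedContinuousFunction.evalCLM_apply, BoundedContinuousFunction.smul_apply,
    BoundedContinuousFunction.mul_apply, translate_apply, sub_neg_eq_add, smul_eq_mul] at hint
  unfold berezin
  rw [pairBerezin_apply ht hf hg, Measure.volume_eq_prod, integral_prod _ hint,
    mul_apply_eq_comp, eval_toeplitz, ← integral_add_left_eq_self _ z,
    ← integral_const_mul]
  congr 1
  funext u
  rw [eval_toeplitz, ← integral_add_left_eq_self _ z, ← integral_const_mul,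
    ← integral_const_mul, ← integral_const_mul]
  congr 1
  funext v
  rw [eval_expKernel, ← bergman_covariance z u v]
  ring

/-- The Berezin transform of an operator in `T_lin(S)` is in the closed linear span of `S`. -/
theorem mem_closedSpan_of_mem_toeplitzLin (ht : 0 < t) {S : Set (Cn n →ᵇ ℂ)} (hsub : S ⊆ BUC n)
    (hS : AlphaInvariant S) {A : FockOp n t p} (hA : A ∈ toeplitzLin ht p S) {b : Cn n →ᵇ ℂ}
    (hb : ∀ z, berezin ht A z = b z) : b ∈ closedSpan S := by
  have hspan : ∀ T ∈ Submodule.span ℂ (toeplitz ht p '' S),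
      ∃ c ∈ closedSpan S, ∀ z, berezin ht T z = c z := by
    intro T hT
    induction hT using Submodule.span_induction with
    | mem x hx =>
      obtain ⟨f, hf, rfl⟩ := hx
      exact ⟨heat t f, heat_mem_closedSpan ht hsub hS hf, berezin_toeplitz ht (hsub hf)⟩
    | zero => exact ⟨0, zero_mem _, fun z => by simp [berezin]⟩
    | add x y _ _ hx hy =>
      obtain ⟨c, hc, hc'⟩ := hx
      obtain ⟨d, hd, hd'⟩ := hy
      exact ⟨c + d, add_mem hc hd, fun z => by
        rw [BoundedContinuousFunction.add_apply, ← hc', ← hd']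
        simp [berezin, mul_add]⟩
    | smul a x _ hx =>
      obtain ⟨c, hc, hc'⟩ := hx
      exact ⟨a • c, Submodule.smul_mem _ a hc, fun z => by
        rw [BoundedContinuousFunction.smul_apply, ← hc']
        simp [berezin, mul_left_comm]⟩
  rw [← SetLike.mem_coe, ← (isClosed_closedSpan S).closure_eq, Metric.mem_closure_iff]
  intro ε hε
  have hC := evalConst_nonneg (n := n) (p := p) ht
  -- `evalConst` is only known to be nonnegative; the `+ 1` keeps the denominator positive.
  obtain ⟨T, hT, hAT⟩ := Metric.mem_closure_iff.1 hA (ε / (2 * (evalConst n ht p + 1)))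
    (by positivity)
  obtain ⟨c, hc, hc'⟩ := hspan T hT
  refine ⟨c, hc, lt_of_le_of_lt ?_ (half_lt_self hε)⟩
  refine (BoundedContinuousFunction.dist_le (by positivity)).2 fun z => ?_
  rw [dist_eq_norm, ← hb, ← hc', ← berezin_sub]
  rw [dist_eq_norm] at hAT
  calc _ ≤ _ := norm_berezin_le ht (A - T) z
    _ ≤ (evalConst n ht p + 1) * (ε / (2 * (evalConst n ht p + 1))) := by gcongr; linarith
    _ = ε / 2 := by field_simp

/-! ### Injectivity of the heat transform. -/

theorem exists_herm_re_eq (L : StrongDual ℝ (Cn n)) : ∃ a : Cn n, ∀ w, L w = (herm w a).re := by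
  refine ⟨fun i => L (Pi.single i 1) + L (Pi.single i Complex.I) * Complex.I, fun w => ?_⟩
  have h1 : w = ∑ i, ((w i).re • Pi.single (M := fun _ => ℂ) i 1 +
      (w i).im • Pi.single (M := fun _ => ℂ) i Complex.I) := by
    funext j
    simp [Finset.sum_apply, Pi.single_apply, Finset.sum_add_distrib]
  conv_lhs => rw [h1]
  rw [map_sum, herm, Complex.re_sum]
  refine Finset.sum_congr rfl fun i _ => ?_
  simp

/-- Completing the square: tilting a Gaussian by a real exponential translates its centre, up to a
constant. Thus exponential moments against `μ_t` are values of heat transforms. -/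
theorem gaussianDensity_mul_exp (ht : 0 < t) (a w : Cn n) :
    gaussianDensity n t w * Real.exp (herm w a).re =
      Real.exp (t / 4 * sqNorm a) * gaussianDensity n t (w - ((t / 2 : ℝ) : ℂ) • a) := by
  have h1 : sqNorm (((t / 2 : ℝ) : ℂ) • a) = (t / 2) ^ 2 * sqNorm a := by
    simp only [sqNorm, Pi.smul_apply, norm_smul, mul_pow, Finset.mul_sum, Complex.norm_real,
      Real.norm_eq_abs, sq_abs]
  have h2 : (herm w (((t / 2 : ℝ) : ℂ) • a)).re = t / 2 * (herm w a).re := by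
    rw [herm_re_comm, herm_smul_left, Complex.re_ofReal_mul, herm_re_comm]
  unfold gaussianDensity
  rw [mul_left_comm, mul_assoc, ← Real.exp_add, ← Real.exp_add, sqNorm_sub, h1, h2]
  congr 2
  field_simp
  ring

theorem integrable_exp_herm_re (ht : 0 < t) (a : Cn n) :
    Integrable (fun w => Real.exp (herm w a).re) (gaussianMeasure n t) := by
  rw [integrable_gaussianMeasure_iff ht]
  simp only [smul_eq_mul, gaussianDensity_mul_exp ht]
  exact ((integrable_gaussianDensity ht).comp_sub_right _).const_mul _

/-- Finite measures on `ℂⁿ` with the same exponential moments are equal. -/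
theorem measure_ext_of_integral_exp {μ ν : Measure (Cn n)} [IsFiniteMeasure μ] [IsFiniteMeasure ν]
    (hμ : ∀ a : Cn n, Integrable (fun w => Real.exp (herm w a).re) μ)
    (h : ∀ a : Cn n, ∫ w, Real.exp (herm w a).re ∂μ = ∫ w, Real.exp (herm w a).re ∂ν) :
    μ = ν := by
  -- The moment at `a = 0` is the total mass; it rules out that only one of the two measures is
  -- zero.
  have hzero : ∀ {ρ : Measure (Cn n)} [IsFiniteMeasure ρ],
      ρ = 0 ↔ ∫ w, Real.exp (herm w (0 : Cn n)).re ∂ρ = 0 := by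
    intro ρ _
    simp [herm, measureReal_def, ENNReal.toReal_eq_zero_iff]
  refine Measure.ext_of_charFunDual (funext fun L => ?_)
  obtain ⟨a, ha⟩ := exists_herm_re_eq L
  have hL : ∀ (s : ℝ) (w : Cn n), s * L w = (herm w ((s : ℂ) • a)).re := fun s w => by
    rw [herm_re_comm, herm_smul_left, Complex.re_ofReal_mul, herm_re_comm, ha]
  have hset : ProbabilityTheory.integrableExpSet L μ = Set.univ := by
    refine Set.eq_univ_of_forall fun s => ?_
    simp only [ProbabilityTheory.integrableExpSet, Set.mem_ofPred_eq, hL]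
    exact hμ _
  have hmgf : ProbabilityTheory.mgf L μ = ProbabilityTheory.mgf L ν := by
    funext s
    simp only [ProbabilityTheory.mgf, hL]
    exact h _
  -- With all real exponential moments finite, the complex moment generating functions agree on the
  -- whole plane; at `Complex.I` they are the characteristic functions.
  have h1 := ProbabilityTheory.eqOn_complexMGF_of_mgf' hmgf (by rw [hzero, hzero, h])
    (x := Complex.I) (by simp [hset])
  simp only [ProbabilityTheory.complexMGF] at h1
  simpa only [charFunDual_apply, mul_comm] using h1

/-- The heat transform is injective on bounded continuous functions. -/
theorem eq_zero_of_integral_gaussianMeasure (ht : 0 < t) {h : Cn n → ℝ} (hc : Continuous h)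
    {M : ℝ} (hM : ∀ z, |h z| ≤ M) (hz : ∀ x, ∫ z, h (x + z) ∂gaussianMeasure n t = 0)
    (z : Cn n) : h z = 0 := by
  have := isProbabilityMeasure_gaussianMeasure (n := n) ht
  have hM0 : 0 ≤ M := (abs_nonneg _).trans (hM 0)
  have hpos : ∀ w, 0 ≤ M + h w := fun w => by
    have := neg_le_of_abs_le (hM w); linarith
  have hexp : ∀ a : Cn n, Continuous fun w : Cn n => Real.exp (herm w a).re := fun a => by fun_prop
  have hint : ∀ a : Cn n, Integrable (fun w => h w * Real.exp (herm w a).re)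
      (gaussianMeasure n t) := fun a =>
    (integrable_exp_herm_re ht a).bdd_mul hc.aestronglyMeasurable (c := M)
      (Filter.Eventually.of_forall hM)
  have hzero : ∀ a : Cn n, ∫ w, h w * Real.exp (herm w a).re ∂gaussianMeasure n t = 0 := by
    intro a
    -- The vanishing heat transform at the shifted centre `t a / 2` is, up to a positive factor, the
    -- exponential moment at `a`.
    have h1 := hz (((t / 2 : ℝ) : ℂ) • a)
    rw [integral_gaussianMeasure ht, ← integral_sub_right_eq_self _ (((t / 2 : ℝ) : ℂ) • a)] at h1
    simp only [add_sub_cancel, smul_eq_mul] at h1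
    rw [integral_gaussianMeasure ht]
    have h2 : ∀ w, gaussianDensity n t w • (h w * Real.exp (herm w a).re) =
        Real.exp (t / 4 * sqNorm a) *
          (gaussianDensity n t (w - ((t / 2 : ℝ) : ℂ) • a) * h w) := fun w => by
      rw [← mul_assoc, ← gaussianDensity_mul_exp ht, smul_eq_mul]
      ring
    simp only [h2]
    rw [integral_const_mul, h1, mul_zero]
  have hm1 : Measurable fun w => ENNReal.ofReal (M + h w) :=
    (by fun_prop : Continuous fun w => M + h w).measurable.ennreal_ofReal
  have hm2 : Measurable fun _ : Cn n => ENNReal.ofReal M := measurable_const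
  have hi1 : Integrable (fun w => M + h w) (gaussianMeasure n t) :=
    (integrable_const M).add (Integrable.of_bound hc.aestronglyMeasurable M
      (Filter.Eventually.of_forall hM))
  have hf1 : IsFiniteMeasure ((gaussianMeasure n t).withDensity
      fun w => ENNReal.ofReal (M + h w)) := isFiniteMeasure_withDensity_ofReal hi1.2
  have hf2 : IsFiniteMeasure ((gaussianMeasure n t).withDensity
      fun _ => ENNReal.ofReal M) :=
    isFiniteMeasure_withDensity_ofReal (integrable_const (α := Cn n) M).2
  -- Adding the constant `M` makes the density nonnegative, so uniqueness for positive measures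
  -- compares `(M + h) μ_t` with `M μ_t`.
  have heq := measure_ext_of_integral_exp
    (μ := (gaussianMeasure n t).withDensity fun w => ENNReal.ofReal (M + h w))
    (ν := (gaussianMeasure n t).withDensity fun _ => ENNReal.ofReal M)
    (fun a => by
      rw [integrable_withDensity_iff_integrable_smul' hm1
        (Filter.Eventually.of_forall fun _ => ENNReal.ofReal_lt_top)]
      simp only [ENNReal.toReal_ofReal (hpos _), smul_eq_mul, add_mul]
      exact ((integrable_exp_herm_re ht a).const_mul M).add (hint a))
    (fun a => by
      rw [integral_withDensity_eq_integral_toReal_smul hm1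
        (Filter.Eventually.of_forall fun _ => ENNReal.ofReal_lt_top),
        integral_withDensity_eq_integral_toReal_smul hm2
        (Filter.Eventually.of_forall fun _ => ENNReal.ofReal_lt_top)]
      simp only [ENNReal.toReal_ofReal (hpos _), ENNReal.toReal_ofReal hM0, smul_eq_mul, add_mul]
      rw [integral_add ((integrable_exp_herm_re ht a).const_mul M) (hint a), hzero, add_zero])
  have hae := (withDensity_eq_iff_of_sigmaFinite hm1.aemeasurable hm2.aemeasurable).1 heq
  have hae' : h =ᵐ[volume] fun _ => 0 := by
    filter_upwards [(volume_ac ht).ae_le hae] with w hw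
    have := (ENNReal.ofReal_eq_ofReal_iff (hpos w) hM0).1 hw
    linarith
  exact congrFun ((hc.ae_eq_iff_eq volume continuous_const).1 hae') z

/-! ### The Gaussian average of translated products. -/

theorem integrable_exp_prod_prod {b : ℝ} (hb : 0 < b) :
    Integrable fun q : Cn n × (Cn n × Cn n) => Real.exp (-b * sqNorm q.1) *
      (Real.exp (-b * sqNorm q.2.1) * Real.exp (-b * sqNorm q.2.2)) :=
  (integrable_exp_sqNorm hb).mul_prod (integrable_exp_prod hb)

/-- A continuous function on `(ℂⁿ)³` with Gaussian decay is integrable. -/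
theorem integrable_of_norm_le_exp {F : Cn n × (Cn n × Cn n) → ℂ} (hF : Continuous F) {b C : ℝ}
    (hb : 0 < b) (h : ∀ q, ‖F q‖ ≤
      C * Real.exp (-(b * (sqNorm q.1 + sqNorm q.2.1 + sqNorm q.2.2)))) : Integrable F := by
  refine ((integrable_exp_prod_prod hb).const_mul C).mono' hF.aestronglyMeasurable
    (Filter.Eventually.of_forall fun q => (h q).trans (le_of_eq ?_))
  rw [← Real.exp_add, ← Real.exp_add]
  congr 2
  ring

theorem norm_mul_le_of_le_mul {a b : ℂ} {A B : ℝ} (ha : ‖a‖ ≤ A) (hb : ‖b‖ ≤ B) :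
    ‖a * b‖ ≤ A * B := by
  rw [norm_mul]
  exact mul_le_mul ha hb (norm_nonneg _) ((norm_nonneg _).trans ha)

/-- The growth allowed for `H` cancels the weight of the kernel at `w` and leaves only the decay in
`x - w`. -/
theorem norm_bergman_mul_le (ht : 0 < t) {H : Cn n → ℂ} {M : ℝ}
    (hM : ∀ w, ‖H w‖ ≤ M * Real.exp (sqNorm w / (2 * t))) (x w : Cn n) :
    ‖bergman n t x w * H w‖ ≤ 1 / (Real.pi * t) ^ n * M *
      Real.exp ((sqNorm x - sqNorm (x - w)) / (2 * t)) := by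
  refine (norm_mul_le_of_le_mul (norm_bergman ht x w).le (hM w)).trans (le_of_eq ?_)
  rw [mul_mul_mul_comm, ← Real.exp_add]
  congr 2
  field_simp
  ring

theorem continuous_symbol_pair (f g : Cn n →ᵇ ℂ) :
    Continuous fun q : Cn n × (Cn n × Cn n) => f q.2.1 * g q.2.2 :=
  (f.continuous.comp continuous_snd.fst).mul (g.continuous.comp continuous_snd.snd)

theorem norm_symbol_pair_le (f g : Cn n →ᵇ ℂ) (u v : Cn n) : ‖f u * g v‖ ≤ ‖f‖ * ‖g‖ :=
  norm_mul_le_of_le_mul (f.norm_coe_le_norm u) (g.norm_coe_le_norm v)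

theorem integrable_toeplitz_pairBerezin (ht : 0 < t) {H : Cn n → ℂ} (hH : Continuous H) {M : ℝ}
    (hM : ∀ w, ‖H w‖ ≤ M * Real.exp (sqNorm w / (2 * t))) (f g : Cn n →ᵇ ℂ) (x : Cn n) :
    Integrable fun q : Cn n × (Cn n × Cn n) =>
      bergman n t x q.1 * H q.1 * pairKernel n t (q.2.1 - q.1, q.2.2 - q.1) *
        (f q.2.1 * g q.2.2) := by
  have hpi := Real.pi_pos
  have hM0 : 0 ≤ M := by
    have := (norm_nonneg _).trans (hM 0)
    exact nonneg_of_mul_nonneg_left this (Real.exp_pos _)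
  -- By `|a + b|² ≤ 2|a|² + 2|b|²`, the sum `|z|² + |u|² + |v|²` is at most `10 (|x - z|² + |u - z|²
  -- + |v - z|²) + 10 |x|²`. The available decay rate `1 / (2t)` therefore leaves `1 / (20t)`.
  refine integrable_of_norm_le_exp (b := 1 / (20 * t))
    (C := 1 / (Real.pi * t) ^ n * M * (1 / (Real.pi * t) ^ n) ^ 2 * (‖f‖ * ‖g‖) *
      Real.exp (20 * sqNorm x / (20 * t))) ?_ (by positivity) fun q => ?_
  · refine Continuous.mul (Continuous.mul ?_ ?_) (continuous_symbol_pair f g)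
    · fun_prop
    · exact continuous_pairKernel.comp (by fun_prop)
  obtain ⟨z, u, v⟩ := q
  refine (norm_mul_le_of_le_mul (norm_mul_le_of_le_mul (norm_bergman_mul_le ht hM x z)
    (norm_pairKernel_le ht _)) (norm_symbol_pair_le f g u v)).trans ?_
  dsimp only
  rw [← Real.exp_add]
  have h1 : Real.exp ((sqNorm x - sqNorm (x - z)) / (2 * t)) *
      Real.exp (-(1 / (2 * t)) * sqNorm (u - z) + -(1 / (2 * t)) * sqNorm (v - z)) ≤
      Real.exp (20 * sqNorm x / (20 * t)) *
        Real.exp (-(1 / (20 * t) * (sqNorm z + sqNorm u + sqNorm v))) := by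
    rw [← Real.exp_add, ← Real.exp_add, Real.exp_le_exp]
    have e1 : sqNorm z ≤ 2 * sqNorm (x - z) + 2 * sqNorm x := by
      have := sqNorm_add_le (-(x - z)) x
      rwa [sqNorm_neg, neg_sub, sub_add_cancel] at this
    have e2 : sqNorm u ≤ 2 * sqNorm (u - z) + 2 * sqNorm z := by
      have := sqNorm_add_le (u - z) z
      rwa [sub_add_cancel] at this
    have e3 : sqNorm v ≤ 2 * sqNorm (v - z) + 2 * sqNorm z := by
      have := sqNorm_add_le (v - z) z
      rwa [sub_add_cancel] at this
    have n1 := sqNorm_nonneg (u - z)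
    have n2 := sqNorm_nonneg (v - z)
    rw [show (sqNorm x - sqNorm (x - z)) / (2 * t) + (-(1 / (2 * t)) * sqNorm (u - z) +
        -(1 / (2 * t)) * sqNorm (v - z)) = (10 * (sqNorm x - sqNorm (x - z) - sqNorm (u - z) -
        sqNorm (v - z))) / (20 * t) by field_simp; ring,
      show 20 * sqNorm x / (20 * t) + -(1 / (20 * t) * (sqNorm z + sqNorm u + sqNorm v)) =
        (20 * sqNorm x - (sqNorm z + sqNorm u + sqNorm v)) / (20 * t) by field_simp; ring]
    gcongr
    linarith
  calc _ = 1 / (Real.pi * t) ^ n * M * (1 / (Real.pi * t) ^ n) ^ 2 * (‖f‖ * ‖g‖) *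
        (Real.exp ((sqNorm x - sqNorm (x - z)) / (2 * t)) *
      Real.exp (-(1 / (2 * t)) * sqNorm (u - z) + -(1 / (2 * t)) * sqNorm (v - z))) := by ring
    _ ≤ 1 / (Real.pi * t) ^ n * M * (1 / (Real.pi * t) ^ n) ^ 2 * (‖f‖ * ‖g‖) *
        (Real.exp (20 * sqNorm x / (20 * t)) *
        Real.exp (-(1 / (20 * t) * (sqNorm z + sqNorm u + sqNorm v)))) := by gcongr
    _ = _ := by ring

theorem integrable_average_toeplitz_mul (ht : 0 < t) {H : Cn n → ℂ} (hH : Continuous H) {M : ℝ}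
    (hM : ∀ w, ‖H w‖ ≤ M * Real.exp (sqNorm w / (2 * t))) (f g : Cn n →ᵇ ℂ) (x : Cn n) :
    Integrable fun q : Cn n × (Cn n × Cn n) =>
      gaussianDensity n t q.1 * (bergman n t x (q.1 + q.2.1) *
        (bergman n t (q.1 + q.2.1) (q.1 + q.2.2) * H (q.1 + q.2.2))) *
        (f q.2.1 * g q.2.2) := by
  have hpi := Real.pi_pos
  have hM0 : 0 ≤ M := by
    have := (norm_nonneg _).trans (hM 0)
    exact nonneg_of_mul_nonneg_left this (Real.exp_pos _)
  set c := 1 / (Real.pi * t) ^ n with hc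
  have hc0 : 0 ≤ c := by positivity
  -- Here `|z|² + |u|² + |v|² ≤ 7 (|x - (z + u)|² + |u - v|²) + 14 |z|² + 12 |x|²`. The rates `1 /
  -- (2t)` and `1 / t` leave `1 / (14t)`, and the factor in `x` carries `7 + 12 = 19`.
  refine integrable_of_norm_le_exp (b := 1 / (14 * t))
    (C := c * (c * (c * M)) * (‖f‖ * ‖g‖) *
      Real.exp (19 * sqNorm x / (14 * t))) ?_ (by positivity) fun q => ?_
  · refine Continuous.mul (Continuous.mul ?_ ?_) (continuous_symbol_pair f g)
    · exact Complex.continuous_ofReal.comp (continuous_gaussianDensity.comp continuous_fst)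
    · fun_prop
  obtain ⟨z, u, v⟩ := q
  have hg : ‖(gaussianDensity n t z : ℂ)‖ ≤ c * Real.exp (-sqNorm z / t) := by
    rw [Complex.norm_real, Real.norm_of_nonneg (gaussianDensity_pos ht z).le]
    rfl
  have hb : ‖bergman n t x (z + u) * (bergman n t (z + u) (z + v) * H (z + v))‖ ≤
      c * (c * M) * Real.exp ((sqNorm x - sqNorm (x - (z + u)) - sqNorm (u - v)) / (2 * t)) := by
    refine (norm_mul_le_of_le_mul (norm_bergman ht x (z + u)).le
      (norm_bergman_mul_le ht hM (z + u) (z + v))).trans (le_of_eq ?_)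
    rw [add_sub_add_left_eq_sub, mul_mul_mul_comm, ← Real.exp_add]
    congr 2
    field_simp
    ring
  refine (norm_mul_le_of_le_mul (norm_mul_le_of_le_mul hg hb)
    (norm_symbol_pair_le f g u v)).trans ?_
  dsimp only
  have h1 : Real.exp (-sqNorm z / t) *
      Real.exp ((sqNorm x - sqNorm (x - (z + u)) - sqNorm (u - v)) / (2 * t)) ≤
      Real.exp (19 * sqNorm x / (14 * t)) *
        Real.exp (-(1 / (14 * t) * (sqNorm z + sqNorm u + sqNorm v))) := by
    rw [← Real.exp_add, ← Real.exp_add, Real.exp_le_exp]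
    have e1 : sqNorm u ≤ 2 * sqNorm (x - (z + u)) + 2 * sqNorm (x - z) := by
      have := sqNorm_add_le (-(x - (z + u))) (x - z)
      rwa [sqNorm_neg, show -(x - (z + u)) + (x - z) = u by abel] at this
    have e2 : sqNorm (x - z) ≤ 2 * sqNorm x + 2 * sqNorm z := by
      have := sqNorm_add_le x (-z)
      rwa [sqNorm_neg, ← sub_eq_add_neg] at this
    have e3 : sqNorm v ≤ 2 * sqNorm (u - v) + 2 * sqNorm u := by
      have := sqNorm_add_le (-(u - v)) u
      rwa [sqNorm_neg, neg_sub, sub_add_cancel] at this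
    have n1 := sqNorm_nonneg (u - v)
    have n2 := sqNorm_nonneg (x - (z + u))
    have n3 := sqNorm_nonneg x
    have n4 := sqNorm_nonneg z
    rw [show -sqNorm z / t + (sqNorm x - sqNorm (x - (z + u)) - sqNorm (u - v)) / (2 * t) =
        (7 * (sqNorm x - sqNorm (x - (z + u)) - sqNorm (u - v)) - 14 * sqNorm z) / (14 * t) by
        field_simp; ring,
      show 19 * sqNorm x / (14 * t) + -(1 / (14 * t) * (sqNorm z + sqNorm u + sqNorm v)) =
        (19 * sqNorm x - (sqNorm z + sqNorm u + sqNorm v)) / (14 * t) by field_simp; ring,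
      div_le_div_iff_of_pos_right (by positivity)]
    linarith
  calc _ = c * (c * (c * M)) * (‖f‖ * ‖g‖) * (Real.exp (-sqNorm z / t) *
      Real.exp ((sqNorm x - sqNorm (x - (z + u)) - sqNorm (u - v)) / (2 * t))) := by ring
    _ ≤ c * (c * (c * M)) * (‖f‖ * ‖g‖) * (Real.exp (19 * sqNorm x / (14 * t)) *
        Real.exp (-(1 / (14 * t) * (sqNorm z + sqNorm u + sqNorm v)))) := by gcongr
    _ = _ := by ring

/-- The reproducing formula with respect to `μ_{t/2}`. -/
theorem integral_bergman_half_mul (ht : 0 < t) {H : Cn n → ℂ} (hH : Differentiable ℂ H) {M : ℝ}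
    (hM : ∀ w, ‖H w‖ ≤ M * Real.exp (sqNorm w / (2 * t))) (y d : Cn n) :
    ∫ w, bergman n (t / 2) y w * (Complex.exp (herm w d / t) * H w) =
      Complex.exp (herm y d / t) * H y := by
  have hpi := Real.pi_pos
  have hHc := hH.continuous
  refine integral_bergman_mul (half_pos ht) ((differentiable_exp_herm d).mul hH) ?_
  have hb : (0 : ℝ) < 1 / (4 * t) := by positivity
  refine ((integrable_exp_sqNorm hb).const_mul (1 / (Real.pi * (t / 2)) ^ n * M *
    Real.exp ((sqNorm y + sqNorm (d + d)) / t))).mono'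
    (Continuous.aestronglyMeasurable (by fun_prop)) (Filter.Eventually.of_forall fun w => ?_)
  have h1 : ‖Complex.exp (herm w d / t)‖ ≤ Real.exp ((herm w d).re / t) := by
    rw [Complex.norm_exp, Complex.div_ofReal_re]
  refine (norm_mul_le_of_le_mul (norm_bergman (half_pos ht) y w).le
    (norm_mul_le_of_le_mul h1 (hM w))).trans ?_
  have hM0 : 0 ≤ M := by
    have := (norm_nonneg _).trans (hM 0)
    exact nonneg_of_mul_nonneg_left this (Real.exp_pos _)
  have h2 : Real.exp ((sqNorm y - sqNorm w - sqNorm (y - w)) / (2 * (t / 2))) *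
      Real.exp ((herm w d).re / t) * Real.exp (sqNorm w / (2 * t)) ≤
      Real.exp ((sqNorm y + sqNorm (d + d)) / t) * Real.exp (-(1 / (4 * t)) * sqNorm w) := by
    rw [← Real.exp_add, ← Real.exp_add, ← Real.exp_add, Real.exp_le_exp]
    have e1 : 4 * (herm w d).re ≤ sqNorm w + sqNorm (d + d) := by
      have := two_mul_re_herm_le w (d + d)
      rw [herm_add_right, Complex.add_re] at this
      linarith
    have n1 := sqNorm_nonneg (y - w)
    have n2 := sqNorm_nonneg (d + d)
    rw [show (sqNorm y - sqNorm w - sqNorm (y - w)) / (2 * (t / 2)) + (herm w d).re / t +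
        sqNorm w / (2 * t) = (4 * (sqNorm y - sqNorm w - sqNorm (y - w)) + 4 * (herm w d).re +
        2 * sqNorm w) / (4 * t) by field_simp; ring,
      show (sqNorm y + sqNorm (d + d)) / t + -(1 / (4 * t)) * sqNorm w =
        (4 * (sqNorm y + sqNorm (d + d)) - sqNorm w) / (4 * t) by field_simp; ring]
    gcongr
    linarith
  calc _ = 1 / (Real.pi * (t / 2)) ^ n * M *
        (Real.exp ((sqNorm y - sqNorm w - sqNorm (y - w)) / (2 * (t / 2))) *
      Real.exp ((herm w d).re / t) * Real.exp (sqNorm w / (2 * t))) := by ring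
    _ ≤ 1 / (Real.pi * (t / 2)) ^ n * M * (Real.exp ((sqNorm y + sqNorm (d + d)) / t) *
        Real.exp (-(1 / (4 * t)) * sqNorm w)) := by gcongr
    _ = _ := by ring

/-- The heart of the averaging identity: with the arguments `a`, `b` of the symbols frozen, the
kernels on the two sides agree after integrating out `z`. Each integrand has quadratic part
`-2|z|²/t`, so it is a Bergman kernel for `t / 2` times an entire function. The reproducing formula
evaluates both at the same point, and only constant exponents remain to be compared. -/
theorem integral_bergman_mul_pairKernel (ht : 0 < t) {H : Cn n → ℂ} (hH : Differentiable ℂ H)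
    {M : ℝ} (hM : ∀ w, ‖H w‖ ≤ M * Real.exp (sqNorm w / (2 * t))) (x a b : Cn n) :
    ∫ z, bergman n t x z * H z * pairKernel n t (a - z, b - z) =
      ∫ z, gaussianDensity n t z * (bergman n t x (z + a) *
        (bergman n t (z + a) (z + b) * H (z + b))) := by
  have htc : (t : ℂ) ≠ 0 := by exact_mod_cast ht.ne'
  have hpi : (Real.pi : ℂ) ≠ 0 := by exact_mod_cast Real.pi_ne_zero
  set c : ℂ := 1 / (Real.pi * t : ℂ) ^ n with hc
  set c' : ℂ := 1 / (Real.pi * (t / 2 : ℝ) : ℂ) ^ n with hc'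
  have hc0 : c' ≠ 0 := by
    rw [hc']; push_cast
    exact one_div_ne_zero (pow_ne_zero _ (mul_ne_zero hpi (div_ne_zero htc two_ne_zero)))
  clear_value c c'
  -- The terms linear in `conj z` add up to `(x + b) ⬝ conj z / t`; for parameter `t / 2` this
  -- places the base point at the midpoint of `x` and `b`.
  set y : Cn n := (1 / 2 : ℂ) • (x + b) with hy
  have hyl : ∀ w, herm y w = 1 / 2 * (herm x w + herm b w) := fun w => by
    rw [hy, herm_smul_left, herm_add_left]
  have hz0 : ∀ w : Cn n, herm 0 w = 0 := fun w => by simp [herm]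
  have h1 : ∀ z, bergman n t x z * H z * pairKernel n t (a - z, b - z) =
      c ^ 3 / c' * Complex.exp ((herm a b - herm a a - herm b b) / t) *
        (bergman n (t / 2) y z * (Complex.exp (herm z a / t) * H z)) := by
    intro z
    have h : Complex.exp ((herm x z - herm z z) / t) *
        (Complex.exp ((herm 0 (a - z) - herm (a - z) (a - z)) / t) *
        Complex.exp ((herm (a - z) (b - z) - herm (b - z) (b - z)) / t)) =
        Complex.exp ((herm a b - herm a a - herm b b) / t) *
        (Complex.exp ((herm y z - herm z z) / (t / 2 : ℝ)) * Complex.exp (herm z a / t)) := by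
      simp only [← Complex.exp_add]
      congr 1
      push_cast
      simp only [hyl, hz0, herm_sub_left, herm_sub_right]
      field_simp
      ring
    unfold pairKernel bergman
    rw [← hc, ← hc']
    field_simp
    linear_combination (c ^ 3 * H z) * h
  have h2 : ∀ z, gaussianDensity n t (z - b) * (bergman n t x (z - b + a) *
      (bergman n t (z - b + a) (z - b + b) * H (z - b + b))) =
      c ^ 3 / c' * Complex.exp ((herm x a - herm x b + herm a b - herm a a - 2 * herm b b +
        herm b a) / t) *
        (bergman n (t / 2) y z * (Complex.exp (herm z (b + b - a) / t) * H z)) := by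
    intro z
    have h : Complex.exp (-herm (z - b) (z - b) / t) *
        (Complex.exp ((herm x (z - b + a) - herm (z - b + a) (z - b + a)) / t) *
        Complex.exp ((herm (z - b + a) z - herm z z) / t)) =
        Complex.exp ((herm x a - herm x b + herm a b - herm a a - 2 * herm b b +
        herm b a) / t) *
        (Complex.exp ((herm y z - herm z z) / (t / 2 : ℝ)) *
        Complex.exp (herm z (b + b - a) / t)) := by
      simp only [← Complex.exp_add]
      congr 1
      push_cast
      simp only [hyl, herm_sub_left, herm_sub_right, herm_add_left, herm_add_right]
      field_simp
      ring
    rw [sub_add_cancel]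
    unfold gaussianDensity bergman
    push_cast
    rw [← herm_self, ← hc]
    push_cast at hc' h
    rw [← hc', div_mul_eq_mul_div, div_mul_eq_mul_div, eq_div_iff hc0]
    linear_combination (c ^ 3 * c' * H z) * h
  -- The shift by `b` makes the argument of `H` equal to `z`, as on the other side.
  rw [← integral_sub_right_eq_self (fun z => (gaussianDensity n t z : ℂ) *
    (bergman n t x (z + a) * (bergman n t (z + a) (z + b) * H (z + b)))) b]
  simp only [h1, h2]
  rw [integral_const_mul, integral_const_mul, integral_bergman_half_mul ht hH hM,
    integral_bergman_half_mul ht hH hM, mul_assoc, mul_assoc, ← mul_assoc (Complex.exp _),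
    ← mul_assoc (Complex.exp _), ← Complex.exp_add, ← Complex.exp_add]
  congr 3
  simp only [hyl, herm_sub_right, herm_add_right]
  field_simp
  ring

theorem eval_growth (ht : 0 < t) (h : FockSpace n t p) (w : Cn n) :
    ‖eval ht w h‖ ≤ evalConst n ht p * ‖h‖ * Real.exp (sqNorm w / (2 * t)) := by
  rw [mul_right_comm]
  exact norm_eval_apply_le ht w h

theorem eval_toeplitz_pairBerezin (ht : 0 < t) {f g : Cn n →ᵇ ℂ} (hf : f ∈ BUC n)
    (hg : g ∈ BUC n) (h : FockSpace n t p) (x : Cn n) :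
    eval ht x (toeplitz ht p (pairBerezin t f g) h) =
      ∫ z, ∫ q : Cn n × Cn n, bergman n t x z * eval ht z h *
        pairKernel n t (q.1 - z, q.2 - z) * (f q.1 * g q.2) := by
  have : (volume : Measure (Cn n × Cn n)).IsAddLeftInvariant :=
    Measure.prod.instIsAddLeftInvariant
  rw [eval_toeplitz]
  congr 1
  funext z
  -- Shifting both variables by `-z` frees the symbols from `z`, so that `z` can later be integrated
  -- out with the symbols fixed.
  rw [pairBerezin_apply ht hf hg, ← integral_add_left_eq_self _ (-z, -z),
    ← integral_mul_const, ← integral_const_mul]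
  congr 1
  funext q
  simp only [Prod.fst_add, Prod.snd_add, add_neg_cancel_left]
  rw [show (-z, -z) + q = (q.1 - z, q.2 - z) from
    Prod.ext (neg_add_eq_sub z q.1) (neg_add_eq_sub z q.2)]
  ring

/-- Shifting both integration variables by `z` moves the translation from the symbols to the
kernels. -/
theorem eval_toeplitz_mul_translate (ht : 0 < t) (f g : Cn n →ᵇ ℂ) (h : FockSpace n t p)
    (x z : Cn n) :
    eval ht x ((toeplitz ht p (translate z f) * toeplitz ht p (translate z g)) h) =
      ∫ u, ∫ v, bergman n t x (z + u) *
        (bergman n t (z + u) (z + v) * eval ht (z + v) h) * (f u * g v) := by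
  rw [mul_apply_eq_comp, eval_toeplitz, ← integral_add_left_eq_self _ z]
  congr 1
  funext u
  rw [eval_toeplitz, ← integral_add_left_eq_self _ z, ← integral_const_mul, ← integral_const_mul]
  congr 1
  funext v
  simp only [translate_apply, add_sub_cancel_left]
  ring

/-- Both sides are triple integrals of `f u * g v` against kernels in `z`, `u`, `v`. The two
Gaussian bounds allow `z` to be integrated first, and there the kernels coincide. -/
theorem integral_eval_toeplitz_mul_translate (ht : 0 < t) {f g : Cn n →ᵇ ℂ} (hf : f ∈ BUC n)
    (hg : g ∈ BUC n) (h : FockSpace n t p) (x : Cn n) :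
    ∫ z, eval ht x ((toeplitz ht p (translate z f) * toeplitz ht p (translate z g)) h)
      ∂gaussianMeasure n t = eval ht x (toeplitz ht p (pairBerezin t f g) h) := by
  have hd := differentiable_eval ht h
  have hA := integrable_average_toeplitz_mul ht hd.continuous (eval_growth ht h) f g x
  have hB := integrable_toeplitz_pairBerezin ht hd.continuous (eval_growth ht h) f g x
  rw [eval_toeplitz_pairBerezin ht hf hg, integral_integral_swap hB,
    integral_gaussianMeasure ht]
  simp only [integral_mul_const]
  simp only [integral_bergman_mul_pairKernel ht hd (eval_growth ht h), ← integral_mul_const]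
  rw [← integral_integral_swap hA]
  refine integral_congr_ae ?_
  filter_upwards [hA.prod_right_ae] with z hz
  rw [eval_toeplitz_mul_translate, Measure.volume_eq_prod, integral_prod _ hz, Complex.real_smul,
    ← integral_const_mul]
  congr 1
  funext u
  rw [← integral_const_mul]
  congr 1
  funext v
  ring

theorem continuous_toeplitz_translate (ht : 0 < t) {f : Cn n →ᵇ ℂ} (hf : f ∈ BUC n) :
    Continuous fun z => toeplitz ht p (translate z f) :=
  (toeplitzL n ht p).continuous.comp (continuous_translate hf)

theorem norm_toeplitz_translate_le (ht : 0 < t) (f : Cn n →ᵇ ℂ) (z : Cn n) :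
    ‖toeplitz ht p (translate z f)‖ ≤ (projBound n t).toReal * ‖f‖ :=
  (norm_toeplitz_le_mul ht _).trans
    (mul_le_mul_of_nonneg_left (norm_translate_le z f) ENNReal.toReal_nonneg)

theorem norm_toeplitz_mul_translate_le (ht : 0 < t) (f g : Cn n →ᵇ ℂ) (z : Cn n) :
    ‖toeplitz ht p (translate z f) * toeplitz ht p (translate z g)‖ ≤
      (projBound n t).toReal * ‖f‖ * ((projBound n t).toReal * ‖g‖) :=
  (norm_mul_le _ _).trans (mul_le_mul (norm_toeplitz_translate_le ht f z)
    (norm_toeplitz_translate_le ht g z) (norm_nonneg _) (by positivity))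

theorem integrable_toeplitz_mul_translate (ht : 0 < t) {f g : Cn n →ᵇ ℂ} (hf : f ∈ BUC n)
    (hg : g ∈ BUC n) :
    Integrable (fun z => toeplitz ht p (translate z f) * toeplitz ht p (translate z g))
      (gaussianMeasure n t) := by
  have := isProbabilityMeasure_gaussianMeasure (n := n) ht
  exact Integrable.of_bound ((continuous_toeplitz_translate ht hf).mul
    (continuous_toeplitz_translate ht hg)).aestronglyMeasurable _
    (Filter.Eventually.of_forall (norm_toeplitz_mul_translate_le ht f g))

/-- The Gaussian average of the translates of `T_f T_g` is the Toeplitz operator whose symbol is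
the Berezin transform of `T_f T_g`. -/
theorem integral_toeplitz_mul_translate (ht : 0 < t) {f g : Cn n →ᵇ ℂ} (hf : f ∈ BUC n)
    (hg : g ∈ BUC n) :
    ∫ z, toeplitz ht p (translate z f) * toeplitz ht p (translate z g) ∂gaussianMeasure n t =
      toeplitz ht p (pairBerezin t f g) := by
  have := completeSpace_fockSpace (n := n) (p := p) ht
  refine ContinuousLinearMap.ext fun h => ext_eval ht fun x => ?_
  rw [← integral_eval_toeplitz_mul_translate ht hf hg h x]
  exact (((eval ht x).comp (ContinuousLinearMap.apply ℂ (FockSpace n t p) h)).integral_comp_comm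
    (integrable_toeplitz_mul_translate ht hf hg)).symm

/-! ### The criterion for products, independent of `p`. -/

/-- A product of two Toeplitz operators is in `T_lin(S)` if and only if its Berezin transform, which
does not depend on `p`, is in the closed linear span of `S`. -/
theorem toeplitz_mul_mem_toeplitzLin_iff (ht : 0 < t) {S : Set (Cn n →ᵇ ℂ)} (hsub : S ⊆ BUC n)
    (hS : AlphaInvariant S) {f g : Cn n →ᵇ ℂ} (hf : f ∈ BUC n) (hg : g ∈ BUC n) :
    toeplitz ht p f * toeplitz ht p g ∈ toeplitzLin ht p S ↔ pairBerezin t f g ∈ closedSpan S := by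
  refine ⟨fun h => mem_closedSpan_of_mem_toeplitzLin ht hsub hS h
    (berezin_toeplitz_mul ht hf hg), fun h => ?_⟩
  have := completeSpace_fockSpace (n := n) (p := p) ht
  by_contra hA
  obtain ⟨L, u, hL, hu⟩ := geometric_hahn_banach_closed_point (E := FockOp n t p)
    ((toeplitzLin ht p S).restrictScalars ℝ).convex
    (Submodule.isClosed_topologicalClosure (Submodule.span ℂ (toeplitz ht p '' S))) hA
  have hu0 : 0 < u := by simpa using hL 0 (zero_mem _)
  -- A linear functional bounded above on a subspace vanishes there: otherwise rescaling `T` would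
  -- attain the value `u`.
  have hL0 : ∀ T ∈ toeplitzLin ht p S, L T = 0 := by
    intro T hT
    by_contra hne
    have h1 := hL ((u / L T) • T) (((toeplitzLin ht p S).restrictScalars ℝ).smul_mem _ hT)
    rw [map_smul, smul_eq_mul, div_mul_cancel₀ _ hne] at h1
    exact lt_irrefl _ h1
  have htr : ∀ x z, translate z (translate x f) = translate (x + z) f ∧
      translate z (translate x g) = translate (x + z) g := fun x z => by
    rw [translate_translate, translate_translate, add_comm z x]
    exact ⟨rfl, rfl⟩
  have hzero := eq_zero_of_integral_gaussianMeasure (n := n) ht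
    (h := fun z => L (toeplitz ht p (translate z f) * toeplitz ht p (translate z g)))
    (M := ‖L‖ * ((projBound n t).toReal * ‖f‖ * ((projBound n t).toReal * ‖g‖)))
    (L.continuous.comp ((continuous_toeplitz_translate ht hf).mul
      (continuous_toeplitz_translate ht hg)))
    (fun z => (L.le_opNorm _).trans (mul_le_mul_of_nonneg_left
      (norm_toeplitz_mul_translate_le ht f g z) (norm_nonneg L)))
    -- The average of the function shifted by `x` is `L` of the Toeplitz operator with symbol
    -- `translate x (pairBerezin t f g)`, which lies in `T_lin(S)` by α-invariance.
    (fun x => by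
      have hfx := translate_mem_BUC x hf
      have hgx := translate_mem_BUC x hg
      have h1 := L.integral_comp_comm (integrable_toeplitz_mul_translate (p := p) ht hfx hgx)
      rw [integral_toeplitz_mul_translate ht hfx hgx, ← translate_pairBerezin ht hf hg,
        hL0 _ (toeplitz_mem_toeplitzLin ht (translate_mem_closedSpan hS x h))] at h1
      simpa only [(htr x _).1, (htr x _).2] using h1) 0
  have h0 : ∀ k : Cn n →ᵇ ℂ, translate 0 k = k := fun k => by ext w; simp
  simp only [h0] at hzero
  linarith

/-! ### Reduction of algebra and ideal conditions to generators. -/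

/-- Products of closed linear spans are controlled by the generators. -/
theorem mul_mem_of_mem_topologicalClosure_span {R : Type*} [NormedRing R] [NormedAlgebra ℂ R]
    {X Y : Set R} {W : Submodule ℂ R} (hW : IsClosed (W : Set R))
    (h : ∀ x ∈ X, ∀ y ∈ Y, x * y ∈ W) {a b : R}
    (ha : a ∈ (Submodule.span ℂ X).topologicalClosure)
    (hb : b ∈ (Submodule.span ℂ Y).topologicalClosure) : a * b ∈ W :=
  map_mem_of_mem_topologicalClosure_span ((ContinuousLinearMap.mul ℂ R).flip b) hW
    (fun x hx => map_mem_of_mem_topologicalClosure_span (ContinuousLinearMap.mul ℂ R x) hW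
      (h x hx) hb) ha

theorem toeplitzLin_mono (ht : 0 < t) (p : Exponent) {S T : Set (Cn n →ᵇ ℂ)} (h : S ⊆ T) :
    toeplitzLin ht p S ≤ toeplitzLin ht p T :=
  Submodule.topologicalClosure_mono (Submodule.span_mono (Set.image_mono h))

theorem isClosed_toeplitzLin (ht : 0 < t) (p : Exponent) (S : Set (Cn n →ᵇ ℂ)) :
    IsClosed (toeplitzLin ht p S : Set (FockOp n t p)) :=
  Submodule.isClosed_topologicalClosure _

theorem toeplitz_mem_toeplitzLin_of_mem (ht : 0 < t) {S : Set (Cn n →ᵇ ℂ)} {f : Cn n →ᵇ ℂ}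
    (hf : f ∈ S) : toeplitz ht p f ∈ toeplitzLin ht p S :=
  toeplitz_mem_toeplitzLin ht (subset_closedSpan S hf)

theorem toeplitzLin_eq_toeplitzAlg_iff (ht : 0 < t) (p : Exponent) (S : Set (Cn n →ᵇ ℂ)) :
    (toeplitzLin ht p S : Set (FockOp n t p)) = toeplitzAlg ht p S ↔
      ∀ f ∈ S, ∀ g ∈ S, toeplitz ht p f * toeplitz ht p g ∈ toeplitzLin ht p S := by
  constructor
  · intro h f hf g hg
    have hmem : ∀ k ∈ S, toeplitz ht p k ∈ toeplitzAlg ht p S := fun k hk => by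
      rw [← SetLike.mem_coe, ← h]
      exact toeplitz_mem_toeplitzLin_of_mem ht hk
    rw [← SetLike.mem_coe, h]
    exact mul_mem (hmem f hf) (hmem g hg)
  · intro h
    have hmul : ∀ a ∈ toeplitzLin ht p S, ∀ b ∈ toeplitzLin ht p S,
        a * b ∈ toeplitzLin ht p S := fun a ha b hb =>
      mul_mem_of_mem_topologicalClosure_span (isClosed_toeplitzLin ht p S)
        (by rintro _ ⟨f, hf, rfl⟩ _ ⟨g, hg, rfl⟩; exact h f hf g hg) ha hb
    refine Set.Subset.antisymm ?_ ?_
    · refine closure_mono ?_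
      exact Submodule.span_le (p := (NonUnitalAlgebra.adjoin ℂ (toeplitz ht p '' S)).toSubmodule).2
        (NonUnitalAlgebra.subset_adjoin ℂ)
    · let W : NonUnitalSubalgebra ℂ (FockOp n t p) :=
        { toeplitzLin ht p S with mul_mem' := fun {a b} ha hb => hmul a ha b hb }
      refine closure_minimal (NonUnitalAlgebra.adjoin_le (S := W) ?_) (isClosed_toeplitzLin ht p S)
      rintro _ ⟨f, hf, rfl⟩
      exact toeplitz_mem_toeplitzLin_of_mem ht hf

/-- Multiplication is bilinear and continuous and `T_lin(I)` is closed, so absorption need only be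
tested on generators. -/
theorem isLeftIdealIn_toeplitzLin_iff (ht : 0 < t) (p : Exponent) {I S : Set (Cn n →ᵇ ℂ)}
    (h : I ⊆ S) : IsLeftIdealIn (toeplitzLin ht p I) (toeplitzLin ht p S) ↔
      ∀ f ∈ S, ∀ g ∈ I, toeplitz ht p f * toeplitz ht p g ∈ toeplitzLin ht p I := by
  refine ⟨fun H f hf g hg => H.2 _ (toeplitz_mem_toeplitzLin_of_mem ht hf) _
    (toeplitz_mem_toeplitzLin_of_mem ht hg), fun H => ⟨toeplitzLin_mono ht p h, ?_⟩⟩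
  exact fun a ha b hb => mul_mem_of_mem_topologicalClosure_span (isClosed_toeplitzLin ht p I)
    (by rintro _ ⟨f, hf, rfl⟩ _ ⟨g, hg, rfl⟩; exact H f hf g hg) ha hb

theorem isRightIdealIn_toeplitzLin_iff (ht : 0 < t) (p : Exponent) {I S : Set (Cn n →ᵇ ℂ)}
    (h : I ⊆ S) : IsRightIdealIn (toeplitzLin ht p I) (toeplitzLin ht p S) ↔
      ∀ f ∈ I, ∀ g ∈ S, toeplitz ht p f * toeplitz ht p g ∈ toeplitzLin ht p I := by
  refine ⟨fun H f hf g hg => H.2 _ (toeplitz_mem_toeplitzLin_of_mem ht hg) _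
    (toeplitz_mem_toeplitzLin_of_mem ht hf), fun H => ⟨toeplitzLin_mono ht p h, ?_⟩⟩
  exact fun a ha b hb => mul_mem_of_mem_topologicalClosure_span (isClosed_toeplitzLin ht p I)
    (by rintro _ ⟨f, hf, rfl⟩ _ ⟨g, hg, rfl⟩; exact H f hf g hg) hb ha

theorem exists_iff_forall_of_independent {P : Exponent → Prop} {Q : Prop} (h : ∀ p, P p ↔ Q) :
    (∃ p, P p) ↔ ∀ p, P p :=
  ⟨fun ⟨p, hp⟩ q => (h q).2 ((h p).1 hp),
    fun H => ⟨⟨2, Set.mem_Ioi.2 one_lt_two⟩, H _⟩⟩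

end Fock

/-! ### The main theorem. -/

theorem mainTheorem6 (n : ℕ) (t : ℝ) (ht : 0 < t)
    (D₀ : Set (Fock.Cn n →ᵇ ℂ)) (hsub : D₀ ⊆ Fock.BUC n) (hclosed : IsClosed D₀)
    (hinv : Fock.AlphaInvariant D₀) :
    ((∃ p : Fock.Exponent,
        (Fock.toeplitzLin ht p D₀ : Set (Fock.FockOp n t p)) = Fock.toeplitzAlg ht p D₀) ↔
      ∀ p : Fock.Exponent,
        (Fock.toeplitzLin ht p D₀ : Set (Fock.FockOp n t p)) = Fock.toeplitzAlg ht p D₀) ∧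
    ((∃ p : Fock.Exponent,
        (Fock.toeplitzLin ht p D₀ : Set (Fock.FockOp n t p)) = Fock.toeplitzAlg ht p D₀) →
      ∀ I : Set (Fock.Cn n →ᵇ ℂ), I ⊆ D₀ → IsClosed I → Fock.AlphaInvariant I →
        ((∃ p : Fock.Exponent,
            Fock.IsLeftIdealIn (Fock.toeplitzLin ht p I) (Fock.toeplitzLin ht p D₀)) ↔
          ∀ p : Fock.Exponent,
            Fock.IsLeftIdealIn (Fock.toeplitzLin ht p I) (Fock.toeplitzLin ht p D₀)) ∧
        ((∃ p : Fock.Exponent,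
            Fock.IsRightIdealIn (Fock.toeplitzLin ht p I) (Fock.toeplitzLin ht p D₀)) ↔
          ∀ p : Fock.Exponent,
            Fock.IsRightIdealIn (Fock.toeplitzLin ht p I) (Fock.toeplitzLin ht p D₀)) ∧
        ((∃ p : Fock.Exponent,
            Fock.IsTwoSidedIdealIn (Fock.toeplitzLin ht p I) (Fock.toeplitzLin ht p D₀)) ↔
          ∀ p : Fock.Exponent,
            Fock.IsTwoSidedIdealIn (Fock.toeplitzLin ht p I) (Fock.toeplitzLin ht p D₀))) := by
  refine ⟨Fock.exists_iff_forall_of_independent fun p =>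
    (Fock.toeplitzLin_eq_toeplitzAlg_iff ht p D₀).trans <|
      forall₂_congr fun f hf => forall₂_congr fun g hg =>
        Fock.toeplitz_mul_mem_toeplitzLin_iff ht hsub hinv (hsub hf) (hsub hg),
    fun _ I hI _ hIinv => ?_⟩
  have hIsub := hI.trans hsub
  -- The product criterion is applied with `S = I`: one factor has its symbol only in `D₀`, so the
  -- criterion asks of the two symbols no more than membership in `BUC`.
  have hleft := fun p => (Fock.isLeftIdealIn_toeplitzLin_iff ht p hI).trans <|
    forall₂_congr fun f hf => forall₂_congr fun g hg =>
      Fock.toeplitz_mul_mem_toeplitzLin_iff ht hIsub hIinv (hsub hf) (hIsub hg)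
  have hright := fun p => (Fock.isRightIdealIn_toeplitzLin_iff ht p hI).trans <|
    forall₂_congr fun f hf => forall₂_congr fun g hg =>
      Fock.toeplitz_mul_mem_toeplitzLin_iff ht hIsub hIinv (hIsub hf) (hsub hg)
  exact ⟨Fock.exists_iff_forall_of_independent hleft, Fock.exists_iff_forall_of_independent hright,
    Fock.exists_iff_forall_of_independent fun p => and_congr (hleft p) (hright p)⟩
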